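/- **Setting.** Let $2\le p<\infty$, $s=2/p$ and $C_*\ge 0$. For $f\in L^2(\mathbb R^2;\mathbb R^2)$ put $\|f\|_{\dot H^\sigma}=\big\||2\pi\xi|^\sigma\hat f(\xi)\big\|_{L^2}$ with $\hat f(\xi)=\int f(x)e^{-2\pi i x\cdot\xi}\,dx$ (so $\|f\|_{\dot H^0}=\|f\|_{L^2}$). We say that $f$ lies in the Gevrey class $\mathcal G^{1/s}$ with Gevrey constant $C_*$ if $f\in L^2$ and $$\|f\|_{\dot H^\sigma}\le C_*^{\sigma+1}\,\sigma^{\sigma/s}\qquad\text{for all real }\sigma\ge 0\quad(0^0=1).$$ A weak solution of the 2D Euler equations in $C([0,T);W^{1,p}(\mathbb R^2))$ is a vector field $u$ in this space such that $u(t)$ is weakly divergence free for every $t\in[0,T)$ and $$\int_0^T\!\!\int_{\mathbb R^2} \big(u\cdot\partial_t\varphi+u\cdot(u\cdot\nabla)\varphi\big)\,dx\,dt+\int_{\mathbb R^2}u(0)\cdot\varphi(0)\,dx=0$$ for all divergence-free $\varphi\in C_c^\infty([0,T)\times\mathbb R^2;\mathbb R^2)$. Let $0<T<\infty$, let $u_1,u_2\in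 C([0,T);W^{1,p}(\mathbb R^2))$ be two weak solutions of the 2D Euler equations such that $u_1(t)-u_2(t)$ lies in $\mathcal G^{1/s}$ with Gevrey constant $C_*$ for every $t\in[0,T)$, and write $D(t)=\|u_1(t)-u_2(t)\|_{L^2}$ and $A(t)=\int_0^t\|\nabla u_1(\tau)\|_{L^p}\,d\tau$, so that $A(t)\le t\,\sup_{[0,t]}\|\nabla u_1\|_{L^p}$. **Theorem.** 1. For every $M<1$ there is a constant $K_*>0$, depending only on $p$, $C_*$ and $M$, such that for every $t\in[0,T)$ with $D\le M$ on $[0,t]$, $$D(t)\le D(0)^{\exp(-K_*A(t))}.$$ 2. For every $B>C_*$ there is a constant $K_*>0$, depending only on $p$, $C_*$ and $B$, such that, for every $t\in[0,T)$ and without any restriction on the size of the difference, $$\frac{D(t)}{B}\le\Big(\frac{D(0)}{B}\Big)^{\exp(-K_*A(t))}.$$ 3. In particular, if $u_1(0)=u_2(0)$ almost everywhere, then $u_1(t)=u_2(t)$ almost everywhere for all $t\in[0,T)$. The constants do not depend on $T$, $u_1$ or $u_2$ otherwise. -/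

import Mathlib

open MeasureTheory Set Filter Topology FourierTransform
open scoped ENNReal ContDiff

noncomputable section

/-- The Euclidean plane `ℝ²`. -/
abbrev Plane : Type := EuclideanSpace ℝ (Fin 2)

/-- `ℂ²`, in which the Fourier transforms of planar vector fields take their values. -/
abbrev CPlane : Type := EuclideanSpace ℂ (Fin 2)

/-- The divergence of a differentiable vector field at the point `x`. -/
def divergenceAt (v : Plane → Plane) (x : Plane) : ℝ :=
  ∑ i : Fin 2, (fderiv ℝ v x (EuclideanSpace.single i 1)) i

/-- `G` is the weak (distributional) gradient of the vector field `v` on `ℝ²`: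
both are locally integrable, and `∫ (∂_e φ) v = - ∫ φ (G e)` for every test function `φ`
and every direction `e`. -/
def HasWeakGradient (v : Plane → Plane) (G : Plane → Plane →L[ℝ] Plane) : Prop :=
  LocallyIntegrable v ∧ LocallyIntegrable G ∧
    ∀ φ : Plane → ℝ, ContDiff ℝ ∞ φ → HasCompactSupport φ → ∀ e : Plane,
      ∫ x, (fderiv ℝ φ x e) • v x = - ∫ x, φ x • G x e

/-- `u ∈ C([0,T); W^{1,p}(ℝ²))`, where `G t` is the weak gradient of `u t`. -/
structure IsContinuousW1p (p T : ℝ) (u : ℝ → Plane → Plane)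
    (G : ℝ → Plane → Plane →L[ℝ] Plane) : Prop where
  memLp : ∀ t ∈ Ico 0 T, MemLp (u t) (ENNReal.ofReal p)
  memLp_grad : ∀ t ∈ Ico 0 T, MemLp (G t) (ENNReal.ofReal p)
  weakGradient : ∀ t ∈ Ico 0 T, HasWeakGradient (u t) (G t)
  continuous : ∀ t ∈ Ico 0 T,
    Tendsto (fun τ => eLpNorm (u τ - u t) (ENNReal.ofReal p)
        + eLpNorm (G τ - G t) (ENNReal.ofReal p)) (𝓝[Ico 0 T] t) (𝓝 0)

/-- `u` is a weak solution on `[0,T) × ℝ²` of the incompressible Euler equations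
`∂ₜ u + u · ∇u + ∇q = 0`, `div u = 0`, with initial velocity `u 0`: each `u t` is weakly
divergence free, and the momentum equation holds against all divergence-free vector fields
`φ ∈ C_c^∞([0,T) × ℝ²; ℝ²)` (restrictions of test fields on `(-∞,T) × ℝ²`). -/
structure IsWeakEulerSolution (T : ℝ) (u : ℝ → Plane → Plane) : Prop where
  divFree : ∀ t ∈ Ico 0 T, ∀ ψ : Plane → ℝ, ContDiff ℝ ∞ ψ → HasCompactSupport ψ →
    ∫ x, fderiv ℝ ψ x (u t x) = 0
  momentum : ∀ φ : ℝ → Plane → Plane,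
    ContDiff ℝ ∞ (Function.uncurry φ) →
    HasCompactSupport (Function.uncurry φ) →
    tsupport (Function.uncurry φ) ⊆ Iio T ×ˢ univ →
    (∀ t x, divergenceAt (φ t) x = 0) →
    (∫ t in Ioo 0 T, ∫ x,
        (inner ℝ (u t x) (deriv (fun τ => φ τ x) t)
          + inner ℝ (u t x) (fderiv ℝ (φ t) x (u t x))))
      + ∫ x, inner ℝ (u 0 x) (φ 0 x) = 0

/-- The inclusion `ℝ² → ℂ²`. -/
def complexifyVec (v : Plane) : CPlane := WithLp.toLp 2 fun i => (v i : ℂ)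

theorem norm_complexifyVec (v : Plane) : ‖complexifyVec v‖ = ‖v‖ := by
  simp [complexifyVec, EuclideanSpace.norm_eq]

theorem continuous_complexifyVec : Continuous complexifyVec := by
  unfold complexifyVec
  fun_prop

theorem memLp_complexifyVec {f : Plane → Plane} (hf : MemLp f 2) :
    MemLp (fun x => complexifyVec (f x)) 2 :=
  hf.of_le (continuous_complexifyVec.comp_aestronglyMeasurable hf.1)
    (Eventually.of_forall fun x => (norm_complexifyVec (f x)).le)

open scoped Classical in
/-- The homogeneous Sobolev seminorm `‖f‖_{Ḣ^σ} = ‖|2πξ|^σ f̂(ξ)‖_{L²}` of a square integrable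
vector field `f`, where `f̂(ξ) = ∫ f(x) e^{-2πi x·ξ} dx` is the Fourier–Plancherel transform;
it is `∞` for `f ∉ L²`. For `σ = 0` it is the `L²` norm. -/
def homSobolevNorm (σ : ℝ) (f : Plane → Plane) : ℝ≥0∞ :=
  if hf : MemLp f 2 then
    eLpNorm (fun ξ : Plane =>
      ((2 * Real.pi * ‖ξ‖) ^ σ : ℝ) •
        (𝓕 ((memLp_complexifyVec hf).toLp _) : Lp CPlane 2 (volume : Measure Plane)) ξ) 2
  else ∞

/-- `f` lies in the Gevrey class `𝒢^η` of order `η` with Gevrey constant `C`: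
`‖f‖_{Ḣ^σ} ≤ C^{σ+1} σ^{ση}` for all real `σ ≥ 0` (with `0⁰ = 1`). -/
def HasGevreyBound (η C : ℝ) (f : Plane → Plane) : Prop :=
  ∀ σ : ℝ, 0 ≤ σ → homSobolevNorm σ f ≤ ENNReal.ofReal (C ^ (σ + 1) * σ ^ (σ * η))

/-- `‖f‖_{L²}` as a real number. -/
def l2Norm (f : Plane → Plane) : ℝ := (eLpNorm f 2).toReal

/-- `∫₀ᵗ ‖G(τ)‖_{L^p} dτ`. -/
def gradLpIntegral (p : ℝ) (G : ℝ → Plane → Plane →L[ℝ] Plane) (t : ℝ) : ℝ :=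
  ∫ τ in (0 : ℝ)..t, (eLpNorm (G τ) (ENNReal.ofReal p)).toReal

/-- `u₁, u₂ ∈ C([0,T); W^{1,p}(ℝ²))`, with weak gradients `G₁, G₂`, are weak solutions of the
2D Euler equations, and `u₁(t) - u₂(t)` lies in `𝒢^η` with Gevrey constant `C`, uniformly
in `t ∈ [0,T)`. -/
structure IsGevreyEulerPair (p η C T : ℝ) (u₁ u₂ : ℝ → Plane → Plane)
    (G₁ G₂ : ℝ → Plane → Plane →L[ℝ] Plane) : Prop where
  regular₁ : IsContinuousW1p p T u₁ G₁
  regular₂ : IsContinuousW1p p T u₂ G₂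
  euler₁ : IsWeakEulerSolution T u₁
  euler₂ : IsWeakEulerSolution T u₂
  gevrey : ∀ t ∈ Ico 0 T, HasGevreyBound η C (u₁ t - u₂ t)

end

/-! The proof is an energy estimate closed by Osgood's lemma. The difference `w = u₁ - u₂` satisfies
`∂ₜw + u₂·∇w + w·∇u₁ + ∇q = 0`. The transport and pressure terms carry no energy, and Hölder's
inequality with `D = ‖w‖_{L²}` gives `(D²)' ≤ 2 ‖∇u₁‖_{L^p} ‖w‖_∞^s D^(2-s)`, `s = 2/p`.

The Gevrey hypothesis controls `‖w‖_∞`. In the plane `‖w‖_∞ ≤ c R (D + R^(-σ) ‖w‖_{Ḣ^σ})` for all `σ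
≥ 2` and `R > 0`. Choosing `R` to balance the two terms and `σ = 2 + log (C/D)` gives `‖w‖_∞ ≤ c' C
D σ^(1/s)`. The power `s` turns `σ^(1/s)` into exactly one logarithm, which is why the Gevrey order
is `1/s`. Hence `(D²)' ≤ K ‖∇u₁‖_{L^p} D² (2 + log (C/D))`. This is an Osgood modulus: for `D` below
`M < L` the logarithm is comparable to `log (L/D)`, and `log (L/D)` decays at most exponentially in
`∫ ‖∇u₁‖_{L^p}`. The three conclusions come from `L = 1`, `L = B` and `D(0) = 0`
(`exists_interpolation_bound_le`, `div_le_rpow_of_osgood`).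

Since the solutions are weak, the energy identity needs justification: `w` is not an admissible test
field. Tested against a fixed divergence-free `φ`, the equation is a scalar ODE with right-hand side
`-⟪F, φ⟫`, where `F = w·∇u₁ + u₂·∇w` lies in `L²`, locally uniformly in time, because `w` has a
smooth representative that is bounded and square integrable together with its gradient.
Divergence-free test fields are dense among the weakly divergence-free `L²` fields: what is
orthogonal to them and divergence free is also curl free, hence zero by Liouville's theorem
(`toLp_mem_closure_divFreeTests`). So `w` lies in the closed span of the test fields, is Lipschitz
in `L²`, and `‖w‖²` has right derivative `-2⟪F, w⟫` (`hasDerivWithinAt_norm_sq_of_weak_deriv`). The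
pressure never appears. -/

/-! ### Fourier inversion on `L¹ ∩ L²` -/

section FourierLp

variable {E F : Type*} [NormedAddCommGroup E] [InnerProductSpace ℝ E] [FiniteDimensional ℝ E]
  [MeasurableSpace E] [BorelSpace E]
  [NormedAddCommGroup F] [InnerProductSpace ℂ F] [CompleteSpace F]

/-- On `L¹ ∩ L²` the inverse Fourier–Plancherel transform is given by the Fourier integral. -/
theorem Lp.fourierInv_ae_eq_integral (g : Lp F 2 (volume : Measure E)) (hg : Integrable g) :
    (𝓕⁻ g : Lp F 2 (volume : Measure E)) =ᵐ[volume] 𝓕⁻ (g : E → F) := by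
  have hcont : Continuous (𝓕⁻ (g : E → F)) := by
    rw [Real.fourierInv_eq_fourier_comp_neg]
    exact VectorFourier.fourierIntegral_continuous Real.continuous_fourierChar
      (by exact continuous_inner) hg.comp_neg
  -- Both sides are compared as distributions. The Plancherel transform agrees with the transform of
  -- tempered distributions (`h1`), the Fourier integral by Fubini (`h4`); either way the transform
  -- moves onto the test function.
  refine ae_eq_of_integral_contDiff_smul_eq
    ((Lp.memLp _).locallyIntegrable (by norm_num)) hcont.locallyIntegrable fun φ hφ hc => ?_
  have hc' : HasCompactSupport (fun x => (φ x : ℂ)) := hc.comp_left (g := Complex.ofReal) rfl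
  have hφ' : ContDiff ℝ ∞ (fun x => (φ x : ℂ)) := Complex.ofRealCLM.contDiff.comp hφ
  set ψ : SchwartzMap E ℂ := hc'.toSchwartzMap hφ' with hψ
  have h1 := congrArg (fun T => T ψ) (Lp.fourierInv_toTemperedDistribution_eq g)
  simp only [TemperedDistribution.fourierInv_apply, Lp.toTemperedDistribution_apply] at h1
  have h2 : ∀ x, ψ x = (φ x : ℂ) := fun x => rfl
  have h3 : ∀ (f : E → F), ∫ x, φ x • f x = ∫ x, ψ x • f x := by
    intro f
    refine integral_congr_ae (Eventually.of_forall fun x => ?_)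
    simp [h2]
  rw [h3, h3, ← h1]
  have h4 := VectorFourier.integral_fourierIntegral_smul_eq_flip (μ := (volume : Measure E))
    (ν := (volume : Measure E)) (L := -(innerₗ E)) (f := (ψ : E → ℂ)) (g := (g : E → F))
    Real.continuous_fourierChar (by exact (continuous_inner (𝕜 := ℝ) (E := E)).neg) ψ.integrable hg
  have h5 : ∀ ξ, (𝓕⁻ ψ : SchwartzMap E ℂ) ξ
      = VectorFourier.fourierIntegral Real.fourierChar volume (-(innerₗ E)) (ψ : E → ℂ) ξ := by
    intro ξ
    rw [SchwartzMap.fourierInv_coe, Real.fourierInv_eq]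
    simp [VectorFourier.fourierIntegral]
  have h6 : ∀ ξ, 𝓕⁻ (g : E → F) ξ
      = VectorFourier.fourierIntegral Real.fourierChar volume (-(innerₗ E)).flip (g : E → F) ξ := by
    intro ξ
    rw [Real.fourierInv_eq]
    simp [VectorFourier.fourierIntegral, real_inner_comm]
  simp only [h5, h6]
  exact h4

theorem eLpNorm_fourierInv_eq {g : E → F} (hg : Integrable g) (hg2 : MemLp g 2) :
    MemLp (𝓕⁻ g) 2 ∧ eLpNorm (𝓕⁻ g) 2 = eLpNorm g 2 := by
  have h0 : (hg2.toLp g : E → F) =ᵐ[volume] g := hg2.coeFn_toLp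
  have h1 := Lp.fourierInv_ae_eq_integral (hg2.toLp g) (hg.congr h0.symm)
  have h2 : 𝓕⁻ (hg2.toLp g : E → F) = 𝓕⁻ g := by
    ext x
    rw [Real.fourierInv_eq, Real.fourierInv_eq]
    refine integral_congr_ae ?_
    filter_upwards [h0] with y hy
    rw [hy]
  rw [h2] at h1
  refine ⟨(memLp_congr_ae h1).1 (Lp.memLp _), ?_⟩
  rw [← eLpNorm_congr_ae h1, ← eLpNorm_congr_ae h0, ← Lp.enorm_def, ← Lp.enorm_def]
  have := (Lp.fourierTransformₗᵢ E F).symm.norm_map (hg2.toLp g)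
  have h3 : ‖(𝓕⁻ (hg2.toLp g) : Lp F 2 (volume : Measure E))‖ = ‖hg2.toLp g‖ := this
  rw [← ofReal_norm, ← ofReal_norm, h3]

omit [CompleteSpace F] in
theorem hasFDerivAt_fourierInv {g : E → F} (hg : Integrable g)
    (hg' : Integrable fun ξ => ‖ξ‖ * ‖g ξ‖) (x : E) :
    DifferentiableAt ℝ (𝓕⁻ g) x ∧ ∀ e, fderiv ℝ (𝓕⁻ g) x e
      = 𝓕⁻ (fun ξ => (2 * Real.pi * Complex.I * (inner ℝ ξ e : ℝ)) • g ξ) x := by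
  have h1 : Integrable fun ξ => g (-ξ) := hg.comp_neg
  have h2 : Integrable fun ξ : E => ‖ξ‖ * ‖g (-ξ)‖ := by
    simpa using hg'.comp_neg
  have h3 := Real.hasFDerivAt_fourier h1 h2 x
  rw [Real.fourierInv_eq_fourier_comp_neg]
  refine ⟨h3.differentiableAt, fun e => ?_⟩
  rw [h3.fderiv, Real.fourierInv_eq_fourier_comp_neg, Real.fourier_continuousLinearMap_apply]
  · refine congrArg (fun f : E → F => 𝓕 f x) (funext fun ξ => ?_)
    rw [VectorFourier.fourierSMulRight_apply, innerSL_apply_apply, inner_neg_left,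
      ← Complex.coe_smul, smul_smul]
    congr 1
    push_cast
    ring
  · refine (h2.const_mul (2 * Real.pi)).mono' ?_ ?_
    · exact h1.aestronglyMeasurable.fourierSMulRight
    · refine Eventually.of_forall fun ξ => ?_
      rw [VectorFourier.norm_fourierSMulRight, innerSL_apply_norm, mul_assoc]

end FourierLp

/-! ### Agmon's inequality in the plane -/

theorem memLp_inv_one_add_sq : MemLp (fun ξ : Plane => (1 + ‖ξ‖ ^ 2)⁻¹) 2 := by
  have hc : Continuous fun ξ : Plane => (1 + ‖ξ‖ ^ 2)⁻¹ := by
    refine Continuous.inv₀ (by fun_prop) fun ξ => by positivity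
  rw [memLp_two_iff_integrable_sq hc.aestronglyMeasurable]
  have h := integrable_rpow_neg_one_add_norm_sq (E := Plane) (μ := volume) (r := 4) (by simp; norm_num)
  refine h.congr (Eventually.of_forall fun ξ => ?_)
  have : (0 : ℝ) < 1 + ‖ξ‖ ^ 2 := by positivity
  simp only
  rw [show (-4 / 2 : ℝ) = -((2 : ℕ) : ℝ) by norm_num, Real.rpow_neg this.le, Real.rpow_natCast, inv_pow]

/-- Dilation by `R` multiplies planar measure by `R²`, hence the `L²` norm by `R`. This is the
factor `R` in front of the Agmon bound. -/
theorem eLpNorm_inv_one_add_sq_scaled {R : ℝ} (hR : 0 < R) :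
    MemLp (fun ξ : Plane => (1 + ‖R⁻¹ • ξ‖ ^ 2)⁻¹) 2 ∧
    eLpNorm (fun ξ : Plane => (1 + ‖R⁻¹ • ξ‖ ^ 2)⁻¹) 2
      = ENNReal.ofReal R * eLpNorm (fun ξ : Plane => (1 + ‖ξ‖ ^ 2)⁻¹) 2 := by
  have h1 := (memLp_two_iff_integrable_sq memLp_inv_one_add_sq.1).1 memLp_inv_one_add_sq
  have hc : Continuous fun ξ : Plane => (1 + ‖R⁻¹ • ξ‖ ^ 2)⁻¹ := by
    refine Continuous.inv₀ (by fun_prop) fun ξ => by positivity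
  have h2 : MemLp (fun ξ : Plane => (1 + ‖R⁻¹ • ξ‖ ^ 2)⁻¹) 2 := by
    rw [memLp_two_iff_integrable_sq hc.aestronglyMeasurable]
    exact h1.comp_smul (inv_ne_zero hR.ne')
  refine ⟨h2, ?_⟩
  rw [h2.eLpNorm_eq_integral_rpow_norm (by norm_num) (by norm_num),
    memLp_inv_one_add_sq.eLpNorm_eq_integral_rpow_norm (by norm_num) (by norm_num),
    ← ENNReal.ofReal_mul hR.le]
  congr 1
  have := Measure.integral_comp_inv_smul (volume : Measure Plane)
    (fun ξ : Plane => ‖(1 + ‖ξ‖ ^ 2)⁻¹‖ ^ (2 : ℝ)) R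
  simp only [ENNReal.toReal_ofNat]
  rw [this, smul_eq_mul, Real.mul_rpow (by positivity) (by positivity)]
  congr 1
  rw [abs_of_pos (by positivity), ← Real.rpow_natCast, ← Real.rpow_mul hR.le]
  simp

theorem eLpNorm_const_mul_norm {α E : Type*} [MeasurableSpace α] {μ : Measure α}
    [NormedAddCommGroup E] {c : ℝ} (hc : 0 ≤ c) (f : α → E) (p : ℝ≥0∞) :
    eLpNorm (fun x => c * ‖f x‖) p μ = ENNReal.ofReal c * eLpNorm f p μ := by
  rw [← eLpNorm_norm f, ← Real.enorm_of_nonneg hc, ← eLpNorm_const_smul]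
  rfl

theorem eLpNorm_le_of_norm_le_add {α E F G : Type*} [MeasurableSpace α] {μ : Measure α}
    [NormedAddCommGroup E] [NormedAddCommGroup F] [NormedAddCommGroup G] {a b : ℝ} (ha : 0 ≤ a)
    (hb : 0 ≤ b) {h : α → E} {f : α → F} {g : α → G} (hf : AEStronglyMeasurable f μ)
    (hg : AEStronglyMeasurable g μ) {p : ℝ≥0∞} (hp : 1 ≤ p)
    (hle : ∀ x, ‖h x‖ ≤ a * ‖f x‖ + b * ‖g x‖) :
    eLpNorm h p μ ≤ ENNReal.ofReal a * eLpNorm f p μ + ENNReal.ofReal b * eLpNorm g p μ := by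
  rw [← eLpNorm_const_mul_norm ha, ← eLpNorm_const_mul_norm hb]
  refine le_trans ?_ (eLpNorm_add_le (hf.norm.const_mul a) (hg.norm.const_mul b) hp)
  exact eLpNorm_mono_real fun x => hle x

/-- Agmon-type bound: `L²` control of `g` and of `|2πξ|^σ g`, `σ ≥ 2`, gives `g ∈ L¹(ℝ²)`. -/
theorem exists_integral_norm_le : ∃ c : ℝ, 0 < c ∧ ∀ (g : Plane → CPlane) (σ R A B : ℝ),
    AEStronglyMeasurable g → 2 ≤ σ → 0 < R → 0 ≤ A → 0 ≤ B →
    eLpNorm g 2 ≤ ENNReal.ofReal A →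
    eLpNorm (fun ξ => ((2 * Real.pi * ‖ξ‖) ^ σ : ℝ) • g ξ) 2 ≤ ENNReal.ofReal B →
    Integrable g ∧ ∫ ξ, ‖g ξ‖ ≤ c * R * (A + R ^ (-σ) * B) := by
  set N : ℝ≥0∞ := eLpNorm (fun ξ : Plane => (1 + ‖ξ‖ ^ 2)⁻¹) 2 with hN
  have hNt : N ≠ ⊤ := memLp_inv_one_add_sq.2.ne
  refine ⟨2 * (N.toReal + 1), by positivity, fun g σ R A B hg hσ hR hA hB h0 h1 => ?_⟩
  have hmeas : AEStronglyMeasurable (fun ξ => (1 + ‖R⁻¹ • ξ‖ ^ 2) • g ξ) :=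
    (by fun_prop : Continuous fun ξ : Plane => 1 + ‖R⁻¹ • ξ‖ ^ 2).aestronglyMeasurable.smul hg
  -- With `r = ‖ξ‖ / R` the claim is `1 + r² ≤ 2 + (2πr)^σ`: trivial for `r ≤ 1`, and `r² ≤ r^σ` for
  -- `r > 1` because `σ ≥ 2`. Cauchy–Schwarz against `(1 + r²)⁻¹` then bounds the `L¹` norm.
  have hpt : ∀ ξ : Plane, ‖(1 + ‖R⁻¹ • ξ‖ ^ 2) • g ξ‖
      ≤ 2 * ‖g ξ‖ + R ^ (-σ) * ‖((2 * Real.pi * ‖ξ‖) ^ σ : ℝ) • g ξ‖ := by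
    intro ξ
    rw [norm_smul (1 + ‖R⁻¹ • ξ‖ ^ 2), norm_smul ((2 * Real.pi * ‖ξ‖) ^ σ),
      Real.norm_of_nonneg (by positivity : 0 ≤ 1 + ‖R⁻¹ • ξ‖ ^ 2),
      Real.norm_of_nonneg (by positivity : 0 ≤ (2 * Real.pi * ‖ξ‖) ^ σ),
      ← mul_assoc, ← add_mul]
    refine mul_le_mul_of_nonneg_right ?_ (norm_nonneg _)
    have hr : ‖R⁻¹ • ξ‖ = R⁻¹ * ‖ξ‖ := by rw [norm_smul, Real.norm_of_nonneg (by positivity)]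
    have h2 : R ^ (-σ) * (2 * Real.pi * ‖ξ‖) ^ σ = (2 * Real.pi * (R⁻¹ * ‖ξ‖)) ^ σ := by
      rw [Real.rpow_neg hR.le, ← Real.inv_rpow hR.le, ← Real.mul_rpow (by positivity) (by positivity)]
      ring_nf
    rw [hr, h2]
    set r := R⁻¹ * ‖ξ‖ with hrd
    have hr0 : 0 ≤ r := by positivity
    rcases le_or_gt r 1 with h | h
    · have : 0 ≤ (2 * Real.pi * r) ^ σ := by positivity
      nlinarith
    · have h3 : r ^ (2 : ℝ) ≤ (2 * Real.pi * r) ^ σ := by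
        calc r ^ (2 : ℝ) ≤ r ^ σ := Real.rpow_le_rpow_of_exponent_le h.le hσ
          _ ≤ _ := Real.rpow_le_rpow hr0 (by nlinarith [Real.pi_gt_three]) (by linarith)
      rw [Real.rpow_two] at h3
      linarith
  have hm2 : AEStronglyMeasurable (fun ξ : Plane => ((2 * Real.pi * ‖ξ‖) ^ σ : ℝ) • g ξ) :=
    ((measurable_norm.const_mul _).pow_const σ).aestronglyMeasurable.smul hg
  have h3 : eLpNorm (fun ξ => (1 + ‖R⁻¹ • ξ‖ ^ 2) • g ξ) 2
      ≤ ENNReal.ofReal (2 * A + R ^ (-σ) * B) := by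
    refine (eLpNorm_le_of_norm_le_add (by norm_num) (by positivity) hg hm2 (by norm_num)
      hpt).trans ?_
    rw [ENNReal.ofReal_add (by positivity) (by positivity), ENNReal.ofReal_mul (by norm_num),
      ENNReal.ofReal_mul (by positivity)]
    gcongr
  obtain ⟨hρ, hρN⟩ := eLpNorm_inv_one_add_sq_scaled hR
  have h4 : eLpNorm g 1 ≤ ENNReal.ofReal R * N * ENNReal.ofReal (2 * A + R ^ (-σ) * B) := by
    have := eLpNorm_smul_le_mul_eLpNorm (p := 2) (q := 2) (r := 1) hmeas hρ.1
    have heq : ((fun ξ : Plane => (1 + ‖R⁻¹ • ξ‖ ^ 2)⁻¹) • fun ξ => (1 + ‖R⁻¹ • ξ‖ ^ 2) • g ξ)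
        = g := by
      ext1 ξ
      have : (1 + ‖R⁻¹ • ξ‖ ^ 2) ≠ 0 := by positivity
      simp only [Pi.smul_apply', smul_smul]
      rw [inv_mul_cancel₀ this, one_smul]
    rw [heq, hρN] at this
    exact this.trans (by gcongr)
  have hfin : ENNReal.ofReal R * N * ENNReal.ofReal (2 * A + R ^ (-σ) * B) ≠ ⊤ := by finiteness
  have hint : Integrable g := memLp_one_iff_integrable.1 ⟨hg, lt_of_le_of_lt h4 hfin.lt_top⟩
  refine ⟨hint, ?_⟩
  have h5 := ENNReal.toReal_mono hfin h4
  rw [eLpNorm_one_eq_lintegral_enorm, ← integral_norm_eq_lintegral_enorm hg, ENNReal.toReal_mul,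
    ENNReal.toReal_mul, ENNReal.toReal_ofReal hR.le, ENNReal.toReal_ofReal (by positivity)] at h5
  refine h5.trans ?_
  have : 0 ≤ R ^ (-σ) * B := by positivity
  have hN0 : 0 ≤ N.toReal := ENNReal.toReal_nonneg
  have h6 : 2 * A + R ^ (-σ) * B ≤ 2 * A + 2 * (R ^ (-σ) * B) := by linarith
  calc R * N.toReal * (2 * A + R ^ (-σ) * B)
      ≤ R * (N.toReal + 1) * (2 * A + 2 * (R ^ (-σ) * B)) := 
        mul_le_mul (by gcongr; linarith) h6 (by positivity) (by positivity)
    _ = _ := by ring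

/-! ### Smooth representatives of Gevrey differences -/

/-- The componentwise real part `ℂ² → ℝ²`. -/
noncomputable def realPartVec : CPlane →L[ℝ] Plane :=
  LinearMap.mkContinuous
    { toFun := fun z => WithLp.toLp 2 fun i => (z i).re
      map_add' := fun x y => by ext i; simp
      map_smul' := fun a x => by ext i; simp } 1 fun z => by
    rw [one_mul, EuclideanSpace.norm_eq, EuclideanSpace.norm_eq]
    refine Real.sqrt_le_sqrt (Finset.sum_le_sum fun i _ => ?_)
    have := Complex.abs_re_le_norm (z i)
    simp only [LinearMap.coe_mk, AddHom.coe_mk, Real.norm_eq_abs]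
    gcongr

theorem realPartVec_complexifyVec (v : Plane) : realPartVec (complexifyVec v) = v := by
  ext i
  simp [realPartVec, complexifyVec]

theorem norm_realPartVec_le (z : CPlane) : ‖realPartVec z‖ ≤ ‖z‖ := by
  have : ‖realPartVec z‖ ≤ 1 * ‖z‖ :=
    ContinuousLinearMap.le_of_opNorm_le _ (LinearMap.mkContinuous_norm_le _ zero_le_one _) z
  rwa [one_mul] at this

theorem norm_fourierInv_le_integral {E F : Type*} [NormedAddCommGroup E] [InnerProductSpace ℝ E]
    [FiniteDimensional ℝ E] [MeasurableSpace E] [BorelSpace E] [NormedAddCommGroup F]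
    [NormedSpace ℂ F] (g : E → F) (x : E) : ‖𝓕⁻ g x‖ ≤ ∫ ξ, ‖g ξ‖ := by
  rw [Real.fourierInv_eq]
  refine (norm_integral_le_integral_norm _).trans (le_of_eq ?_)
  simp

theorem memLp_of_homSobolevNorm_le {σ b : ℝ} {w : Plane → Plane}
    (h : homSobolevNorm σ w ≤ ENNReal.ofReal b) : MemLp w 2 := by
  by_contra hw
  rw [homSobolevNorm, dif_neg hw, top_le_iff] at h
  exact ENNReal.ofReal_ne_top h

/-- An `L²` field all of whose homogeneous Sobolev norms are finite has a smooth representative,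
with explicit bounds. -/
theorem exists_smooth_representative : ∃ c : ℝ, 0 < c ∧ ∀ (w : Plane → Plane) (B : ℝ → ℝ),
    (∀ σ, 0 ≤ σ → 0 ≤ B σ) → (∀ σ, 0 ≤ σ → homSobolevNorm σ w ≤ ENNReal.ofReal (B σ)) →
    ∃ v : Plane → Plane, ContDiff ℝ ∞ v ∧ w =ᵐ[volume] v ∧
      (∀ σ R x, 2 ≤ σ → 0 < R → ‖v x‖ ≤ c * R * (l2Norm w + R ^ (-σ) * B σ)) ∧
      (∀ x e, ‖fderiv ℝ v x e‖ ≤ c * (B 1 + B 3) * ‖e‖) ∧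
      ∀ e, eLpNorm (fun x => fderiv ℝ v x e) 2 ≤ ENNReal.ofReal (B 1 * ‖e‖) := by
  obtain ⟨c, hc, hagmon⟩ := exists_integral_norm_le
  refine ⟨c, hc, fun w B hB hw => ?_⟩
  have hL2 : MemLp w 2 := memLp_of_homSobolevNorm_le (hw 0 le_rfl)
  set W := (memLp_complexifyVec hL2).toLp _ with hW
  set g : Plane → CPlane := ((𝓕 W : Lp CPlane 2 (volume : Measure Plane)) : Plane → CPlane) with hg
  have hgσ : ∀ σ, 0 ≤ σ →
      eLpNorm (fun ξ => ((2 * Real.pi * ‖ξ‖) ^ σ : ℝ) • g ξ) 2 ≤ ENNReal.ofReal (B σ) := by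
    intro σ hσ
    have := hw σ hσ
    rwa [homSobolevNorm, dif_pos hL2] at this
  have hgm : AEStronglyMeasurable g := (Lp.memLp _).1
  have hg0 : eLpNorm g 2 = ENNReal.ofReal (l2Norm w) := by
    rw [l2Norm, ENNReal.ofReal_toReal hL2.2.ne, hg, ← Lp.enorm_def, ← ofReal_norm,
      Lp.norm_fourier_eq, hW, Lp.norm_toLp, ENNReal.ofReal_toReal (memLp_complexifyVec hL2).2.ne]
    exact eLpNorm_congr_norm_ae (Eventually.of_forall fun x => norm_complexifyVec _)
  have hgτm : ∀ τ : ℝ, AEStronglyMeasurable (fun ξ => ((2 * Real.pi * ‖ξ‖) ^ τ : ℝ) • g ξ) :=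
    fun τ => ((measurable_norm.const_mul _).pow_const τ).aestronglyMeasurable.smul hgm
  have hgτ : ∀ τ : ℝ, 0 ≤ τ → Integrable (fun ξ => ((2 * Real.pi * ‖ξ‖) ^ τ : ℝ) • g ξ) ∧
      ∫ ξ, ‖((2 * Real.pi * ‖ξ‖) ^ τ : ℝ) • g ξ‖ ≤ c * (B τ + B (τ + 2)) := by
    intro τ hτ
    -- The Agmon bound for the weighted function `|2πξ|^τ g`, with exponent `2` and `R = 1`, costs
    -- only the seminorms of order `τ` and `τ + 2`. Integer `τ` gives all moments of `g`, hence
    -- smoothness; `τ = 1` gives the gradient bound.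
    have h := hagmon (fun ξ => ((2 * Real.pi * ‖ξ‖) ^ τ : ℝ) • g ξ) 2 1 (B τ) (B (τ + 2))
      (hgτm τ) le_rfl one_pos (hB _ hτ) (hB _ (by linarith)) (hgσ τ hτ) ?_
    · simpa using h
    · refine le_trans (le_of_eq ?_) (hgσ (τ + 2) (by linarith))
      congr 1
      ext1 ξ
      rw [smul_smul, add_comm, Real.rpow_add_of_nonneg (by positivity) (by norm_num) hτ]
  have hgi : Integrable g := by simpa using (hgτ 0 le_rfl).1
  have hpow : ∀ n : ℕ, Integrable fun ξ => ‖ξ‖ ^ n * ‖g ξ‖ := by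
    intro n
    have h := (hgτ n (by positivity)).1.norm.const_mul ((2 * Real.pi) ^ n)⁻¹
    refine h.congr (Eventually.of_forall fun ξ => ?_)
    simp only [norm_smul, Real.rpow_natCast, mul_pow, norm_mul, norm_pow, norm_norm]
    rw [Real.norm_of_nonneg (by norm_num : (0 : ℝ) ≤ 2), Real.norm_of_nonneg Real.pi_pos.le]
    field_simp
  have hWinv : (W : Plane → CPlane) =ᵐ[volume] 𝓕⁻ g := by
    have := Lp.fourierInv_ae_eq_integral (𝓕 W) hgi
    rwa [FourierTransform.fourierInv_fourier_eq] at this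
  have hsm : ContDiff ℝ ∞ (𝓕⁻ g) := by
    rw [Real.fourierInv_eq_fourier_comp_neg]
    refine Real.contDiff_fourier (N := ⊤) fun n _ => ?_
    simpa using (hpow n).comp_neg
  have hder := fun x => hasFDerivAt_fourierInv hgi (by simpa using hpow 1) x
  have hv' : ∀ x e, fderiv ℝ (fun x => realPartVec (𝓕⁻ g x)) x e
      = realPartVec (𝓕⁻ (fun ξ => (2 * Real.pi * Complex.I * (inner ℝ ξ e : ℝ)) • g ξ) x) := by
    intro x e
    rw [← (hder x).2 e]
    have := (realPartVec.hasFDerivAt.comp x (hder x).1.hasFDerivAt).fderiv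
    simp only [Function.comp_def] at this
    rw [this]
    rfl
  have hk : ∀ e ξ : Plane, ‖(2 * Real.pi * Complex.I * (inner ℝ ξ e : ℝ)) • g ξ‖
      ≤ ‖e‖ * ‖((2 * Real.pi * ‖ξ‖) ^ (1 : ℝ) : ℝ) • g ξ‖ := by
    intro e ξ
    rw [norm_smul, norm_smul, ← mul_assoc]
    gcongr
    have := abs_real_inner_le_norm ξ e
    simp only [norm_mul, Complex.norm_I, Complex.norm_real, Real.rpow_one, Complex.norm_ofNat,
      Real.norm_eq_abs, abs_of_pos Real.pi_pos, mul_one, abs_norm, Nat.abs_ofNat]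
    nlinarith [Real.pi_pos]
  have hkm : ∀ e : Plane, AEStronglyMeasurable
      (fun ξ => (2 * Real.pi * Complex.I * (inner ℝ ξ e : ℝ)) • g ξ) := fun e =>
    (by fun_prop : Continuous fun ξ : Plane =>
      (2 * Real.pi * Complex.I * (inner ℝ ξ e : ℝ))).aestronglyMeasurable.smul hgm
  have hki : ∀ e : Plane, Integrable
      (fun ξ => (2 * Real.pi * Complex.I * (inner ℝ ξ e : ℝ)) • g ξ) := fun e =>
    ((hgτ 1 zero_le_one).1.norm.const_mul ‖e‖).mono' (hkm e) (Eventually.of_forall (hk e))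
  have hk2 : ∀ e : Plane, eLpNorm
      (fun ξ => (2 * Real.pi * Complex.I * (inner ℝ ξ e : ℝ)) • g ξ) 2
        ≤ ENNReal.ofReal (B 1 * ‖e‖) := by
    intro e
    refine (eLpNorm_mono_real (hk e)).trans ?_
    rw [eLpNorm_const_mul_norm (norm_nonneg e), mul_comm, ENNReal.ofReal_mul (hB 1 zero_le_one)]
    gcongr
    exact hgσ 1 zero_le_one
  -- The inverse transform is `ℂ²`-valued and only almost everywhere equal to a real field. Taking
  -- the real part keeps smoothness and, having norm at most one, all the bounds.
  refine ⟨fun x => realPartVec (𝓕⁻ g x), realPartVec.contDiff.comp hsm, ?_, ?_, ?_, ?_⟩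
  · filter_upwards [hWinv, (memLp_complexifyVec hL2).coeFn_toLp] with x h1 h2
    rw [← h1, hW, h2, realPartVec_complexifyVec]
  · intro σ R x hσ hR
    refine (norm_realPartVec_le _).trans ((norm_fourierInv_le_integral g x).trans ?_)
    exact (hagmon g σ R (l2Norm w) (B σ) hgm hσ hR ENNReal.toReal_nonneg (hB _ (by linarith))
      hg0.le (hgσ σ (by linarith))).2
  · intro x e
    rw [hv']
    refine (norm_realPartVec_le _).trans ((norm_fourierInv_le_integral _ x).trans ?_)
    calc _ ≤ ∫ ξ, ‖e‖ * ‖((2 * Real.pi * ‖ξ‖) ^ (1 : ℝ) : ℝ) • g ξ‖ :=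
          integral_mono (hki e).norm ((hgτ 1 zero_le_one).1.norm.const_mul _) (hk e)
      _ ≤ _ := by
        rw [integral_const_mul, mul_comm]
        have := (hgτ 1 zero_le_one).2
        rw [show (1 : ℝ) + 2 = 3 by norm_num] at this
        gcongr
  · intro e
    simp only [hv']
    refine le_trans (eLpNorm_mono fun x => norm_realPartVec_le _) ?_
    rw [(eLpNorm_fourierInv_eq (hki e) ⟨hkm e, (hk2 e).trans_lt ENNReal.ofReal_lt_top⟩).2]
    exact hk2 e

/-! ### Density of divergence-free test fields in `L²` -/

/-- `v` is a divergence-free test field on the plane. -/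
structure IsDivFreeTest (v : Plane → Plane) : Prop where
  contDiff : ContDiff ℝ ∞ v
  hasCompactSupport : HasCompactSupport v
  divergence : ∀ x, divergenceAt v x = 0

/-- `f` is weakly divergence free. -/
def IsWeaklyDivFree (f : Plane → Plane) : Prop :=
  ∀ ψ : Plane → ℝ, ContDiff ℝ ∞ ψ → HasCompactSupport ψ → ∫ x, fderiv ℝ ψ x (f x) = 0

/-- The rotated gradient `(-∂₂ψ, ∂₁ψ)`. -/
noncomputable def perpGrad (ψ : Plane → ℝ) (x : Plane) : Plane :=
  !₂[-fderiv ℝ ψ x (EuclideanSpace.single 1 1), fderiv ℝ ψ x (EuclideanSpace.single 0 1)]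

theorem isDivFreeTest_perpGrad {ψ : Plane → ℝ} (hψ : ContDiff ℝ ∞ ψ) (hc : HasCompactSupport ψ) :
    IsDivFreeTest (perpGrad ψ) := by
  have h1 : ∀ e : Plane, ContDiff ℝ ∞ fun x => fderiv ℝ ψ x e := fun e =>
    (hψ.fderiv_right (m := ∞) (by simp)).clm_apply contDiff_const
  have h2 : ContDiff ℝ ∞ (perpGrad ψ) := by
    rw [contDiff_euclidean]
    intro i
    fin_cases i
    · simpa [perpGrad] using (h1 _).neg
    · simpa [perpGrad] using h1 _
  refine ⟨h2, ?_, fun x => ?_⟩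
  · refine (hc.fderiv ℝ).mono fun x hx => ?_
    contrapose! hx
    simp only [Function.mem_support, ne_eq, not_not] at hx ⊢
    ext i
    fin_cases i <;> simp [perpGrad, hx]
  · have hd : ∀ (i : Fin 2) (e : Plane), (fderiv ℝ (perpGrad ψ) x e) i
        = fderiv ℝ (fun y => perpGrad ψ y i) x e := by
      intro i e
      have h := (h2.differentiable (by simp) x).hasFDerivAt
      have h' := ((EuclideanSpace.proj (𝕜 := ℝ) i).hasFDerivAt.comp x h).fderiv
      have h'' : fderiv ℝ (fun y => perpGrad ψ y i) x
        = (EuclideanSpace.proj (𝕜 := ℝ) i).comp (fderiv ℝ (perpGrad ψ) x) := h'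
      rw [h'']
      rfl
    have hsec : ∀ e e' : Plane, fderiv ℝ (fun y => fderiv ℝ ψ y e) x e'
        = fderiv ℝ (fderiv ℝ ψ) x e' e := by
      intro e e'
      have h := ((hψ.fderiv_right (m := ∞) (by simp)).differentiable (by simp) x)
      rw [fderiv_clm_apply h (by fun_prop)]
      simp
    have hsymm := second_derivative_symmetric (f := ψ) (x := x)
      (fun y => (hψ.differentiable (by simp) y).hasFDerivAt)
      ((hψ.fderiv_right (m := ∞) (by simp)).differentiable (by simp) x).hasFDerivAt
    simp only [divergenceAt, Fin.sum_univ_two, hd]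
    simp only [perpGrad, PiLp.toLp_apply, Matrix.cons_val_zero, Matrix.cons_val_one]
    rw [fderiv_fun_neg, neg_apply, hsec, hsec, hsymm]
    ring

theorem plane_eq_sum (v : Plane) :
    v = v 0 • EuclideanSpace.single 0 1 + v 1 • EuclideanSpace.single 1 1 := by
  ext i
  fin_cases i <;> simp

theorem clm_plane_apply {F : Type*} [NormedAddCommGroup F] [NormedSpace ℝ F] (L : Plane →L[ℝ] F)
    (v : Plane) :
    L v = v 0 • L (EuclideanSpace.single 0 1) + v 1 • L (EuclideanSpace.single 1 1) := by
  conv_lhs => rw [plane_eq_sum v]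
  simp

theorem tendsto_integral_translate_mul {ρ g : Plane → ℝ} (hρ : Continuous ρ)
    (hc : HasCompactSupport ρ) (hg : Integrable g) :
    Tendsto (fun x => ∫ y, ρ (x - y) * g y) (cocompact Plane) (𝓝 0) := by
  obtain ⟨C, hC⟩ := hρ.bounded_above_of_compact_support hc
  have : (cocompact Plane).IsCountablyGenerated := by
    rw [← Metric.cobounded_eq_cocompact, ← comap_norm_atTop]
    infer_instance
  rw [← integral_zero Plane ℝ (μ := volume)]
  refine tendsto_integral_filter_of_dominated_convergence (fun y => C * ‖g y‖) ?_ ?_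
    (hg.norm.const_mul C) ?_
  · refine Eventually.of_forall fun x => ?_
    exact (by fun_prop : Continuous fun y => ρ (x - y)).aestronglyMeasurable.mul hg.1
  · refine Eventually.of_forall fun x => Eventually.of_forall fun y => ?_
    rw [norm_mul]
    gcongr
    exact hC _
  · refine Eventually.of_forall fun y => ?_
    have h1 : Tendsto (fun x : Plane => x - y) (cocompact Plane) (cocompact Plane) :=
      (Homeomorph.subRight y).isClosedEmbedding.tendsto_cocompact
    have h2 : Tendsto ρ (cocompact Plane) (𝓝 0) := hc.is_zero_at_infty
    simpa using (h2.comp h1).mul_const (g y)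

/-- Mollified `L²` fields vanish at infinity. Since `t ≤ ε + ε⁻¹ t²`, the integral is at most `ε
‖ρ‖₁` plus `ε⁻¹` times a translate integral of the `L¹` function `‖f‖²`, which tends to zero by
dominated convergence. -/
theorem tendsto_integral_translate_smul {ρ : Plane → ℝ} {f : Plane → Plane} (hρ : Continuous ρ)
    (hc : HasCompactSupport ρ) (hf : MemLp f 2) :
    Tendsto (fun x => ∫ y, ρ (x - y) • f y) (cocompact Plane) (𝓝 0) := by
  have hg : Integrable fun y => ‖f y‖ ^ 2 := (memLp_two_iff_integrable_sq_norm hf.1).1 hf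
  have h1 := tendsto_integral_translate_mul hρ.norm hc.norm hg
  have hρi : ∀ x, Integrable fun y => ‖ρ (x - y)‖ := fun x =>
    ((hρ.integrable_of_hasCompactSupport hc).comp_sub_left x).norm
  have hi2 : ∀ x, Integrable fun y => ‖ρ (x - y)‖ * ‖f y‖ ^ 2 := by
    intro x
    obtain ⟨C, hC⟩ := hρ.bounded_above_of_compact_support hc
    refine hg.bdd_mul (c := C) ?_ ?_
    · exact (by fun_prop : Continuous fun y => ‖ρ (x - y)‖).aestronglyMeasurable
    · exact Eventually.of_forall fun y => by simpa using hC _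
  have hb : ∀ ε > 0, ∀ x, ‖∫ y, ρ (x - y) • f y‖
      ≤ ε * (∫ y, ‖ρ y‖) + ε⁻¹ * ∫ y, ‖ρ (x - y)‖ * ‖f y‖ ^ 2 := by
    intro ε hε x
    rw [← integral_sub_left_eq_self (fun y => ‖ρ y‖) volume x, ← integral_const_mul,
      ← integral_const_mul, ← integral_add ((hρi x).const_mul _) ((hi2 x).const_mul _)]
    refine norm_integral_le_of_norm_le (((hρi x).const_mul _).add ((hi2 x).const_mul _))
      (Eventually.of_forall fun y => ?_)
    rw [norm_smul]
    have h2 : ‖f y‖ ≤ ε + ε⁻¹ * ‖f y‖ ^ 2 := by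
      rw [← sub_nonneg]
      have : ε + ε⁻¹ * ‖f y‖ ^ 2 - ‖f y‖ = ε⁻¹ * ((ε - ‖f y‖ / 2) ^ 2 + 3 / 4 * ‖f y‖ ^ 2) := by
        field_simp
        ring
      rw [this]
      positivity
    have := mul_le_mul_of_nonneg_left h2 (norm_nonneg (ρ (x - y)))
    linarith
  rw [tendsto_zero_iff_norm_tendsto_zero]
  set I := ∫ y, ‖ρ y‖ with hI
  have hI0 : 0 ≤ I := integral_nonneg fun _ => norm_nonneg _
  rw [Metric.tendsto_nhds]
  intro δ hδ
  set ε := δ / (2 * (I + 1)) with hεd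
  have hε : 0 < ε := by positivity
  have hεI : ε * I ≤ δ / 2 := by
    rw [hεd, div_mul_eq_mul_div, div_le_div_iff₀ (by positivity) (by norm_num)]
    nlinarith
  have h3 := (h1.const_mul ε⁻¹)
  rw [mul_zero] at h3
  filter_upwards [h3.eventually (gt_mem_nhds (half_pos hδ))] with x hx
  rw [dist_zero_right, norm_norm]
  have := hb ε hε x
  linarith


open scoped Convolution in
/-- An `L²` field which is weakly divergence free and weakly curl free vanishes. -/
theorem ae_eq_zero_of_divFree_of_curlFree {f : Plane → Plane} (hf : MemLp f 2)
    (hdiv : IsWeaklyDivFree f)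
    (hcurl : ∀ ψ : Plane → ℝ, ContDiff ℝ ∞ ψ → HasCompactSupport ψ →
      ∫ x, inner ℝ (f x) (perpGrad ψ x) = 0) : f =ᵐ[volume] 0 := by
  have hloc : LocallyIntegrable f := hf.locallyIntegrable (by norm_num)
  refine ae_eq_zero_of_integral_contDiff_smul_eq_zero hloc fun ρ' hρ' hc' => ?_
  -- With `ρ` the reflected test function, the integral to be killed is `h 0` for the mollification
  -- `h = ρ ⋆ f`. This `h` satisfies both equations pointwise and vanishes at infinity.
  set ρ : Plane → ℝ := fun x => ρ' (-x) with hρd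
  have hρ : ContDiff ℝ ∞ ρ := hρ'.comp contDiff_neg
  have hc : HasCompactSupport ρ := hc'.comp_homeomorph (Homeomorph.neg Plane)
  set h : Plane → Plane := ρ ⋆[ContinuousLinearMap.lsmul ℝ ℝ, volume] f with hh
  have hconv : ∀ x, h x = ∫ y, ρ (x - y) • f y := by
    intro x
    rw [hh, convolution_def, ← integral_sub_left_eq_self _ volume x]
    simp
  have hlim : Tendsto h (cocompact Plane) (𝓝 0) := by
    rw [show h = fun x => ∫ y, ρ (x - y) • f y from funext hconv]
    exact tendsto_integral_translate_smul hρ.continuous hc hf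
  have hder : ∀ x, HasFDerivAt h
      ((fderiv ℝ ρ ⋆[(ContinuousLinearMap.lsmul ℝ ℝ).precompL Plane, volume] f) x) x := fun x =>
    hc.hasFDerivAt_convolution_left _ (hρ.of_le (by simp)) hloc x
  have hderi : ∀ x e, Integrable fun y => fderiv ℝ ρ (x - y) e • f y := by
    intro x e
    have h1 : Continuous fun y => fderiv ℝ ρ (x - y) e :=
      ((hρ.continuous_fderiv (by simp)).comp (by fun_prop)).clm_apply continuous_const
    refine hloc.integrable_smul_left_of_hasCompactSupport h1 ?_
    have h2 := (hc.fderiv_apply (𝕜 := ℝ) e).comp_homeomorph (Homeomorph.subLeft x)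
    exact h2
  have hder' : ∀ x e, fderiv ℝ h x e = ∫ y, fderiv ℝ ρ (x - y) e • f y := by
    intro x e
    have hce : ConvolutionExists (fderiv ℝ ρ) f
        ((ContinuousLinearMap.lsmul ℝ ℝ).precompL Plane) volume :=
      (hc.fderiv ℝ).convolutionExists_left _ (hρ.continuous_fderiv (by simp)) hloc
    rw [(hder x).fderiv, convolution_def, ContinuousLinearMap.integral_apply (hce x),
      ← integral_sub_left_eq_self _ volume x]
    simp
  -- translated test functions
  have hψ : ∀ x, ContDiff ℝ ∞ (fun y => ρ (x - y)) := fun x =>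
    hρ.comp (contDiff_const.sub contDiff_id)
  have hψc : ∀ x, HasCompactSupport (fun y => ρ (x - y)) := fun x =>
    hc.comp_homeomorph (Homeomorph.subLeft x)
  have hψd : ∀ x y e, fderiv ℝ (fun y => ρ (x - y)) y e = - fderiv ℝ ρ (x - y) e := by
    intro x y e
    have h1 := ((hρ.differentiable (by simp)) (x - y)).hasFDerivAt.comp y
      ((hasFDerivAt_id y).const_sub x)
    have h2 : fderiv ℝ (fun y => ρ (x - y)) y = _ := h1.fderiv
    rw [h2]
    simp
  have hcoord : ∀ x e (i : Fin 2), (fderiv ℝ h x e) i = ∫ y, fderiv ℝ ρ (x - y) e * f y i := by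
    intro x e i
    rw [hder']
    have := (EuclideanSpace.proj (𝕜 := ℝ) i).integral_comp_comm (hderi x e)
    simpa using this.symm
  have hcoordi : ∀ x e (i : Fin 2), Integrable fun y => fderiv ℝ ρ (x - y) e * f y i := by
    intro x e i
    simpa using (EuclideanSpace.proj (𝕜 := ℝ) i).integrable_comp (hderi x e)
  have hD : ∀ x, (fderiv ℝ h x (EuclideanSpace.single 0 1)) 0
      + (fderiv ℝ h x (EuclideanSpace.single 1 1)) 1 = 0 := by
    intro x
    rw [hcoord, hcoord, ← integral_add (hcoordi _ _ _) (hcoordi _ _ _), ← neg_eq_zero,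
      ← integral_neg, ← hdiv _ (hψ x) (hψc x)]
    refine integral_congr_ae (Eventually.of_forall fun y => ?_)
    simp only
    rw [clm_plane_apply (fderiv ℝ _ y), hψd, hψd]
    simp only [smul_eq_mul]
    ring
  have hC : ∀ x, (fderiv ℝ h x (EuclideanSpace.single 0 1)) 1
      = (fderiv ℝ h x (EuclideanSpace.single 1 1)) 0 := by
    intro x
    rw [← sub_eq_zero, hcoord, hcoord, ← integral_sub (hcoordi _ _ _) (hcoordi _ _ _),
      ← neg_eq_zero, ← integral_neg, ← hcurl _ (hψ x) (hψc x)]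
    refine integral_congr_ae (Eventually.of_forall fun y => ?_)
    simp only [perpGrad, hψd, PiLp.inner_apply, Fin.sum_univ_two]
    simp
    ring
  -- the holomorphic function `h₁ - i h₂`
  set ι : ℂ ≃L[ℝ] Plane := Complex.orthonormalBasisOneI.repr.toContinuousLinearEquiv with hι
  have hι1 : ι 1 = EuclideanSpace.single 0 1 := by
    ext i; fin_cases i <;> simp [hι]
  have hιI : ι Complex.I = EuclideanSpace.single 1 1 := by
    ext i; fin_cases i <;> simp [hι]
  set c : Plane →L[ℝ] ℂ := (Complex.conjCLE : ℂ →L[ℝ] ℂ).comp (ι.symm : Plane →L[ℝ] ℂ) with hcd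
  have hcv : ∀ v : Plane, c v = (v 0 : ℂ) - Complex.I * v 1 := by
    intro v
    have : ι.symm v = (v 0 : ℂ) + Complex.I * v 1 := by
      rw [ContinuousLinearEquiv.symm_apply_eq]
      ext i
      fin_cases i <;> simp [hι]
    simp [hcd, this]
    ring
  set H : ℂ → ℂ := fun z => c (h (ι z)) with hH
  have hHd : ∀ z, HasFDerivAt H (c.comp ((fderiv ℝ h (ι z)).comp (ι : ℂ →L[ℝ] Plane))) z := by
    intro z
    exact c.hasFDerivAt.comp z
      (((hder (ι z)).differentiableAt.hasFDerivAt).comp z ι.hasFDerivAt)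
  -- The Cauchy–Riemann equations of `h₁ - i h₂` are exactly `div h = 0` (`hD`) and `curl h = 0`
  -- (`hC`). Liouville's theorem then leaves only zero, since `H` tends to zero at infinity.
  have hhol : Differentiable ℂ H := by
    intro z
    rw [differentiableAt_complex_iff_differentiableAt_real]
    refine ⟨(hHd z).differentiableAt, ?_⟩
    rw [(hHd z).fderiv]
    simp only [ContinuousLinearMap.comp_apply, ContinuousLinearEquiv.coe_coe, hι1, hιI, hcv]
    have e1 := hD (ι z)
    have e2 := hC (ι z)
    rw [eq_neg_of_add_eq_zero_right e1, ← e2, smul_eq_mul, mul_sub, ← mul_assoc, Complex.I_mul_I]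
    push_cast
    ring
  have hlimH : Tendsto H (cocompact ℂ) (𝓝 0) := by
    have h1 := hlim.comp ι.toHomeomorph.isClosedEmbedding.tendsto_cocompact
    have h2 := (c.continuous.tendsto 0).comp h1
    rw [map_zero] at h2
    exact h2
  have h0 : H (ι.symm 0) = 0 := hhol.apply_eq_of_tendsto_cocompact _ hlimH
  have h1 : h 0 = 0 := by
    have h2 : c (h 0) = 0 := by simpa [hH] using h0
    simpa [hcd] using h2
  rw [hconv] at h1
  simpa [hρd] using h1

theorem integral_fderiv_apply_eq_neg {ψ : Plane → ℝ} {v : Plane → Plane} (hψ : ContDiff ℝ ∞ ψ)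
    (hc : HasCompactSupport ψ) (hv : ContDiff ℝ ∞ v) :
    ∫ x, fderiv ℝ ψ x (v x) = - ∫ x, ψ x * divergenceAt v x := by
  have hvd : Differentiable ℝ v := hv.differentiable (by simp)
  have hvi : ∀ (i : Fin 2) x e, fderiv ℝ (fun y => v y i) x e = (fderiv ℝ v x e) i := by
    intro i x e
    have h' := ((EuclideanSpace.proj (𝕜 := ℝ) i).hasFDerivAt.comp x (hvd x).hasFDerivAt).fderiv
    have h'' : fderiv ℝ (fun y => v y i) x
        = (EuclideanSpace.proj (𝕜 := ℝ) i).comp (fderiv ℝ v x) := h'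
    rw [h'']
    rfl
  have hvs : ∀ i : Fin 2, ContDiff ℝ ∞ fun y => v y i := contDiff_euclidean.1 hv
  have hcs : ∀ e : Plane, Continuous fun x => fderiv ℝ ψ x e := fun e =>
    (hψ.continuous_fderiv (by simp)).clm_apply continuous_const
  have hcv : ∀ (i : Fin 2) (e : Plane), Continuous fun x => fderiv ℝ (fun y => v y i) x e :=
    fun i e => ((hvs i).continuous_fderiv (by simp)).clm_apply continuous_const
  have key : ∀ (i : Fin 2) (e : Plane), Integrable (fun x => fderiv ℝ ψ x e * v x i) ∧
      Integrable (fun x => ψ x * fderiv ℝ (fun y => v y i) x e) ∧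
      ∫ x, ψ x * fderiv ℝ (fun y => v y i) x e = - ∫ x, fderiv ℝ ψ x e * v x i := by
    intro i e
    have i1 : Integrable (fun x => fderiv ℝ ψ x e * v x i) :=
      ((hcs e).mul (hvs i).continuous).integrable_of_hasCompactSupport
        (hc.fderiv_apply (𝕜 := ℝ) e).mul_right
    have i2 : Integrable (fun x => ψ x * fderiv ℝ (fun y => v y i) x e) :=
      (hψ.continuous.mul (hcv i e)).integrable_of_hasCompactSupport hc.mul_right
    exact ⟨i1, i2, integral_mul_fderiv_eq_neg_fderiv_mul_of_integrable i1 i2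
      ((hψ.continuous.mul (hvs i).continuous).integrable_of_hasCompactSupport hc.mul_right)
      (fun x _ => hψ.differentiable (by simp) x)
      (fun x _ => (hvs i).differentiable (by simp) x)⟩
  have h1 : ∀ x, fderiv ℝ ψ x (v x) = ∑ i : Fin 2, fderiv ℝ ψ x (EuclideanSpace.single i 1) * v x i := by
    intro x
    rw [clm_plane_apply (fderiv ℝ ψ x), Fin.sum_univ_two]
    simp only [smul_eq_mul]
    ring
  have h2 : ∀ x, ψ x * divergenceAt v x
      = ∑ i : Fin 2, ψ x * fderiv ℝ (fun y => v y i) x (EuclideanSpace.single i 1) := by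
    intro x
    simp only [hvi, divergenceAt, Finset.mul_sum]
  simp only [h1, h2]
  rw [integral_finsetSum _ fun i _ => (key i _).1, integral_finsetSum _ fun i _ => (key i _).2.1,
    ← Finset.sum_neg_distrib]
  refine Finset.sum_congr rfl fun i _ => ?_
  rw [(key i _).2.2, neg_neg]

theorem IsDivFreeTest.memLp {φ : Plane → Plane} (hφ : IsDivFreeTest φ) (p : ℝ≥0∞) :
    MemLp φ p volume :=
  hφ.contDiff.continuous.memLp_of_hasCompactSupport hφ.hasCompactSupport

/-- The set of divergence-free test fields, in `L²`. -/
def divFreeTests : Set (Lp Plane 2 (volume : Measure Plane)) :=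
  {f | ∃ φ, IsDivFreeTest φ ∧ (f : Plane → Plane) =ᵐ[volume] φ}

theorem inner_toLp_eq_integral (g : Lp Plane 2 (volume : Measure Plane)) {N : Plane → Plane}
    (hN : MemLp N 2) : inner ℝ g (hN.toLp N) = ∫ x, inner ℝ (g x) (N x) := by
  rw [L2.inner_def]
  refine integral_congr_ae ?_
  filter_upwards [hN.coeFn_toLp] with x hx
  rw [hx]

theorem exists_memLp_gradient {ψ : Plane → ℝ} (hψ : ContDiff ℝ ∞ ψ) (hc : HasCompactSupport ψ) :
    ∃ N : Plane → Plane, MemLp N 2 ∧ ∀ (u : Plane) x, inner ℝ u (N x) = fderiv ℝ ψ x u := by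
  refine ⟨fun x => (InnerProductSpace.toDual ℝ Plane).symm (fderiv ℝ ψ x), ?_, fun u x => ?_⟩
  · refine Continuous.memLp_of_hasCompactSupport ?_ ?_
    · exact (InnerProductSpace.toDual ℝ Plane).symm.continuous.comp
        (hψ.continuous_fderiv (by simp))
    · exact (hc.fderiv ℝ).comp_left (map_zero _)
  · rw [real_inner_comm, InnerProductSpace.toDual_symm_apply]

/-- Integration by parts makes divergence-free test fields orthogonal to compactly supported
gradients, and an orthogonal complement is a closed subspace. So every element of the closed span
stays weakly divergence free. -/
theorem inner_gradient_eq_zero_of_mem_closure {ψ : Plane → ℝ} (hψ : ContDiff ℝ ∞ ψ)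
    (hc : HasCompactSupport ψ) {N : Plane → Plane} (hN : MemLp N 2)
    (hNv : ∀ (u : Plane) x, inner ℝ u (N x) = fderiv ℝ ψ x u)
    {g : Lp Plane 2 (volume : Measure Plane)}
    (hg : g ∈ (Submodule.span ℝ divFreeTests).topologicalClosure) :
    inner ℝ g (hN.toLp N) = 0 := by
  have hle : (Submodule.span ℝ divFreeTests).topologicalClosure ≤ (ℝ ∙ hN.toLp N)ᗮ := by
    refine Submodule.topologicalClosure_minimal _ ?_ (Submodule.isClosed_orthogonal _)
    rw [Submodule.span_le]
    rintro φ' ⟨φ, hφ, hae⟩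
    rw [SetLike.mem_coe, Submodule.mem_orthogonal_singleton_iff_inner_left, inner_toLp_eq_integral]
    have : ∫ x, inner ℝ (φ' x) (N x) = ∫ x, fderiv ℝ ψ x (φ x) := by
      refine integral_congr_ae ?_
      filter_upwards [hae] with x hx
      rw [hNv, hx]
    rw [this, integral_fderiv_apply_eq_neg hψ hc hφ.contDiff]
    simp [hφ.divergence]
  exact Submodule.mem_orthogonal_singleton_iff_inner_left.1 (hle hg)

/-- The divergence-free test fields are dense among the weakly divergence-free `L²` fields. -/
theorem toLp_mem_closure_divFreeTests {f : Plane → Plane} (hf : MemLp f 2 volume)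
    (hdiv : IsWeaklyDivFree f) :
    hf.toLp f ∈ (Submodule.span ℝ divFreeTests).topologicalClosure := by
  set K := (Submodule.span ℝ divFreeTests).topologicalClosure with hK
  have : CompleteSpace K := (Submodule.isClosed_topologicalClosure _).completeSpace_coe
  set F := hf.toLp f with hF
  set k := K.starProjection F with hk
  have hkK : k ∈ K := Submodule.starProjection_apply_mem K F
  have horth : F - k ∈ Kᗮ := Submodule.sub_starProjection_mem_orthogonal F
  -- The residual of the projection is divergence free, since both `F` and `K` are, and curl free,
  -- since the rotated gradients are themselves test fields in `K`.
  have hz : ((F - k : Lp Plane 2 (volume : Measure Plane)) : Plane → Plane) =ᵐ[volume] 0 := by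
    refine ae_eq_zero_of_divFree_of_curlFree (Lp.memLp _) ?_ ?_
    · intro ψ hψ hc
      obtain ⟨N, hN, hNv⟩ := exists_memLp_gradient hψ hc
      have h1 : inner ℝ (F - k) (hN.toLp N) = 0 := by
        rw [inner_sub_left, inner_gradient_eq_zero_of_mem_closure hψ hc hN hNv hkK, sub_zero,
          inner_toLp_eq_integral, ← hdiv ψ hψ hc]
        refine integral_congr_ae ?_
        filter_upwards [hf.coeFn_toLp] with x hx
        rw [hNv, hF, hx]
      rw [inner_toLp_eq_integral] at h1
      simpa only [hNv] using h1
    · intro ψ hψ hc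
      have ht := isDivFreeTest_perpGrad hψ hc
      rw [← inner_toLp_eq_integral _ (ht.memLp 2)]
      refine Submodule.inner_left_of_mem_orthogonal ?_ horth
      exact Submodule.le_topologicalClosure _ (Submodule.subset_span ⟨_, ht, (ht.memLp 2).coeFn_toLp⟩)
  have h0 : F - k = 0 := Lp.eq_zero_iff_ae_eq_zero.2 hz
  rw [sub_eq_zero.1 h0]
  exact hkK

/-! ### The energy identity for weakly differentiable curves in a Hilbert space -/

section WeakDerivative

variable {H : Type*} [NormedAddCommGroup H] [InnerProductSpace ℝ H]

/-- The mean value inequality bounds `⟪w t - w s, φ⟫` by `L ‖φ‖ (t - s)` on the span, and density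
extends this to the closure. There `φ = w t - w s` is admissible, which gives the Lipschitz bound
after division by its norm. The curve `F` itself need not lie in the closed span. -/
theorem norm_sub_le_of_weak_deriv {V : Set H} {w F : ℝ → H} {a b L : ℝ} (hL : 0 ≤ L)
    (hw : ∀ t ∈ Icc a b, w t ∈ (Submodule.span ℝ V).topologicalClosure)
    (hcont : ∀ φ ∈ V, ContinuousOn (fun τ => inner ℝ (w τ) φ) (Icc a b))
    (hder : ∀ φ ∈ V, ∀ t ∈ Ico a b,
      HasDerivWithinAt (fun τ => inner ℝ (w τ) φ) (-inner ℝ (F t) φ) (Ici t) t)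
    (hF : ∀ t ∈ Ico a b, ‖F t‖ ≤ L) :
    (∀ φ ∈ Submodule.span ℝ V, ∀ t ∈ Ico a b,
      HasDerivWithinAt (fun τ => inner ℝ (w τ) φ) (-inner ℝ (F t) φ) (Ici t) t) ∧
    ∀ s ∈ Icc a b, ∀ t ∈ Icc s b, ‖w t - w s‖ ≤ L * (t - s) := by
  have hspan : ∀ φ ∈ Submodule.span ℝ V, ContinuousOn (fun τ => inner ℝ (w τ) φ) (Icc a b) ∧
      ∀ t ∈ Ico a b,
      HasDerivWithinAt (fun τ => inner ℝ (w τ) φ) (-inner ℝ (F t) φ) (Ici t) t := by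
    intro φ hφ
    induction hφ using Submodule.span_induction with
    | mem φ h => exact ⟨hcont φ h, hder φ h⟩
    | zero => simpa using ⟨continuousOn_const, fun t _ _ => hasDerivWithinAt_const _ _ _⟩
    | add x y _ _ hx hy =>
      simp only [inner_add_right, neg_add]
      exact ⟨hx.1.add hy.1, fun t ht => (hx.2 t ht).add (hy.2 t ht)⟩
    | smul c x _ hx =>
      simp only [inner_smul_right, ← mul_neg]
      exact ⟨hx.1.const_mul c, fun t ht => (hx.2 t ht).const_mul c⟩
  refine ⟨fun φ hφ => (hspan φ hφ).2, fun s hs t ht => ?_⟩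
  have hts : 0 ≤ t - s := by linarith [ht.1]
  have h1 : ∀ φ ∈ Submodule.span ℝ V, |inner ℝ (w t - w s) φ| ≤ L * ‖φ‖ * (t - s) := by
    intro φ hφ
    have := norm_image_sub_le_of_norm_deriv_right_le_segment (f := fun τ => inner ℝ (w τ) φ)
      (f' := fun t => -inner ℝ (F t) φ) (C := L * ‖φ‖) (a := s) (b := b)
      ((hspan φ hφ).1.mono (Icc_subset_Icc_left hs.1))
      (fun x hx => (hspan φ hφ).2 x ⟨hs.1.trans hx.1, hx.2⟩)
      (fun x hx => by
        rw [norm_neg]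
        exact (norm_inner_le_norm _ _).trans
          (mul_le_mul_of_nonneg_right (hF x ⟨hs.1.trans hx.1, hx.2⟩) (norm_nonneg _))) t ht
    rwa [← inner_sub_left] at this
  have h2 : ∀ φ ∈ (Submodule.span ℝ V).topologicalClosure,
      |inner ℝ (w t - w s) φ| ≤ L * ‖φ‖ * (t - s) := by
    intro φ hφ
    have hcl : IsClosed {φ : H | |inner ℝ (w t - w s) φ| ≤ L * ‖φ‖ * (t - s)} :=
      isClosed_le (by fun_prop) (by fun_prop)
    exact closure_minimal (s := (Submodule.span ℝ V : Set H)) h1 hcl hφ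
  have h3 := h2 (w t - w s) (Submodule.sub_mem _ (hw t ⟨hs.1.trans ht.1, ht.2⟩) (hw s hs))
  rw [real_inner_self_eq_norm_sq, abs_of_nonneg (by positivity)] at h3
  rcases (norm_nonneg (w t - w s)).eq_or_lt with h | h
  · rw [← h]; positivity
  · refine le_of_mul_le_mul_right ?_ h
    linarith [h3, sq (‖w t - w s‖)]

/-- If `w` takes values in the closed span of `V` and has weak right derivative `-F`, tested
against `V`, with `F` bounded, then `‖w‖²` has right derivative `-2⟪F, w⟫`. -/
theorem hasDerivWithinAt_norm_sq_of_weak_deriv {V : Set H} {w F : ℝ → H} {a b L : ℝ} (hL : 0 ≤ L)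
    (hw : ∀ t ∈ Icc a b, w t ∈ (Submodule.span ℝ V).topologicalClosure)
    (hcont : ∀ φ ∈ V, ContinuousOn (fun τ => inner ℝ (w τ) φ) (Icc a b))
    (hder : ∀ φ ∈ V, ∀ t ∈ Ico a b,
      HasDerivWithinAt (fun τ => inner ℝ (w τ) φ) (-inner ℝ (F t) φ) (Ici t) t)
    (hF : ∀ t ∈ Ico a b, ‖F t‖ ≤ L) :
    ContinuousOn w (Icc a b) ∧ ∀ t ∈ Ico a b,
      HasDerivWithinAt (fun τ => ‖w τ‖ ^ 2) (-2 * inner ℝ (F t) (w t)) (Ici t) t := by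
  obtain ⟨hspan, hlip⟩ := norm_sub_le_of_weak_deriv hL hw hcont hder hF
  have hlip' : ∀ s ∈ Icc a b, ∀ t ∈ Icc a b, ‖w t - w s‖ ≤ L * |t - s| := by
    intro s hs t ht
    rcases le_total s t with h | h
    · rw [abs_of_nonneg (by linarith)]
      exact hlip s hs t ⟨h, ht.2⟩
    · rw [norm_sub_rev, abs_sub_comm, abs_of_nonneg (by linarith)]
      exact hlip t ht s ⟨h, hs.2⟩
  refine ⟨?_, fun t ht => ?_⟩
  · refine LipschitzOnWith.continuousOn (K := L.toNNReal) (LipschitzOnWith.of_dist_le_mul ?_)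
    intro x hx y hy
    rw [dist_eq_norm, Real.dist_eq, Real.coe_toNNReal L hL]
    exact hlip' y hy x hx
  · have htb : t < b := ht.2
    have htI : t ∈ Icc a b := ⟨ht.1, htb.le⟩
    have hnear : ∀ᶠ τ in 𝓝[>] t, τ ∈ Ioc t b := Ioc_mem_nhdsGT htb
    have hquot : ∀ τ ∈ Ioc t b, ‖(τ - t)⁻¹ • (w τ - w t)‖ ≤ L := by
      intro τ hτ
      have h0 : 0 < τ - t := by linarith [hτ.1]
      rw [norm_smul, Real.norm_of_nonneg (by positivity), inv_mul_le_iff₀ h0, mul_comm]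
      exact hlip t htI τ ⟨hτ.1.le, hτ.2⟩
    -- The difference quotients converge to `-F t` when tested against the span. Being bounded by
    -- `L`, they also converge against the limit point `w t`; in the tolerance below, `2 * L + 1`
    -- replaces `2 * L` to cover `L = 0`.
    have hweak : Tendsto (fun τ => inner ℝ ((τ - t)⁻¹ • (w τ - w t) + F t) (w t)) (𝓝[>] t) (𝓝 0) := by
      rw [Metric.tendsto_nhds]
      intro ε hε
      obtain ⟨φ, hφ, hd⟩ := Metric.mem_closure_iff.1 (hw t htI : w t ∈ closure _)
        (ε / (2 * (2 * L + 1))) (by positivity)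
      have h1 : Tendsto (fun τ => inner ℝ ((τ - t)⁻¹ • (w τ - w t) + F t) φ) (𝓝[>] t) (𝓝 0) := by
        have h2 := hasDerivWithinAt_iff_tendsto_slope.1 (hspan φ hφ t ht)
        rw [Ici_sdiff_left] at h2
        have h3 := h2.add_const (inner ℝ (F t) φ)
        rw [neg_add_cancel] at h3
        refine h3.congr fun τ => ?_
        rw [slope_def_field, inner_add_left, inner_smul_left, inner_sub_left]
        simp [div_eq_inv_mul]
      filter_upwards [hnear, (Metric.tendsto_nhds.1 h1) (ε / 2) (by positivity)] with τ hτ h4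
      rw [dist_zero_right] at h4 ⊢
      set z := (τ - t)⁻¹ • (w τ - w t) + F t with hz
      have hzn : ‖z‖ ≤ 2 * L := (norm_add_le _ _).trans (by linarith [hquot τ hτ, hF t ht])
      have h5 : inner ℝ z (w t) = inner ℝ z (w t - φ) + inner ℝ z φ := by
        rw [inner_sub_right]; ring
      have h6 : ‖inner ℝ z (w t - φ)‖ ≤ 2 * L * (ε / (2 * (2 * L + 1))) := by
        refine (norm_inner_le_norm _ _).trans ?_
        rw [dist_eq_norm] at hd
        gcongr
      have h7 : 2 * L * (ε / (2 * (2 * L + 1))) ≤ ε / 2 := by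
        rw [mul_div_assoc', div_le_div_iff₀ (by positivity) (by norm_num)]
        nlinarith
      rw [h5]
      linarith [norm_add_le (inner ℝ z (w t - φ)) (inner ℝ z φ)]
    rw [hasDerivWithinAt_iff_tendsto_slope, Ici_sdiff_left]
    -- In `‖w τ‖² - ‖w t‖² = 2⟪w τ - w t, w t⟫ + ‖w τ - w t‖²` the quadratic term is `O((τ - t)²)`
    -- by the Lipschitz bound, so weak differentiability suffices.
    have hrem : Tendsto (fun τ => (τ - t)⁻¹ * ‖w τ - w t‖ ^ 2) (𝓝[>] t) (𝓝 0) := by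
      have hup : Tendsto (fun τ => L ^ 2 * (τ - t)) (𝓝[>] t) (𝓝 0) := by
        have : Tendsto (fun τ => L ^ 2 * (τ - t)) (𝓝 t) (𝓝 (L ^ 2 * (t - t))) :=
          Continuous.tendsto (by fun_prop) t
        rw [sub_self, mul_zero] at this
        exact this.mono_left nhdsWithin_le_nhds
      refine squeeze_zero' ?_ ?_ hup
      · filter_upwards [hnear] with τ hτ
        have h0 : 0 < τ - t := by linarith [hτ.1]
        positivity
      · filter_upwards [hnear] with τ hτ
        have h0 : 0 < τ - t := by linarith [hτ.1]
        have := hlip t htI τ ⟨hτ.1.le, hτ.2⟩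
        rw [inv_mul_le_iff₀ h0]
        calc ‖w τ - w t‖ ^ 2 ≤ (L * (τ - t)) ^ 2 := by gcongr
          _ = _ := by ring
    have hsum := (hweak.const_mul 2).add hrem
    have hsum' := hsum.add_const (-2 * inner ℝ (F t) (w t))
    simp only [mul_zero, zero_add] at hsum'
    refine hsum'.congr' ?_
    filter_upwards [hnear] with τ hτ
    have h0 : τ - t ≠ 0 := by linarith [hτ.1] |> fun h : 0 < τ - t => h.ne'
    rw [slope_def_field, inner_add_left, inner_smul_left, inner_sub_left, norm_sub_sq_real,
      real_inner_self_eq_norm_sq]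
    simp only [conj_trivial]
    field_simp
    ring

end WeakDerivative

/-! ### From distributional to right derivatives in time -/

/-- The du Bois-Reymond lemma with initial value: a weak form of `m' = n` on `[0, b)`. -/
theorem eq_add_integral_of_weak_deriv {m n : ℝ → ℝ} {b : ℝ} (hb : 0 < b) (hm : Continuous m)
    (hn : Continuous n)
    (h : ∀ η : ℝ → ℝ, ContDiff ℝ ∞ η → HasCompactSupport η → tsupport η ⊆ Iio b →
      (∫ t in (0 : ℝ)..b, (deriv η t * m t + η t * n t)) + η 0 * m 0 = 0) :
    ∀ t ∈ Icc 0 b, m t = m 0 + ∫ τ in (0 : ℝ)..t, n τ := by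
  set N : ℝ → ℝ := fun t => ∫ τ in (0 : ℝ)..t, n τ with hN
  have hNd : ∀ t, HasDerivAt N (n t) t := fun t =>
    (hn.integral_hasStrictDerivAt 0 t).hasDerivAt
  have hNc : Continuous N := continuous_iff_continuousAt.2 fun t => (hNd t).continuousAt
  set J : ℝ → ℝ := fun t => m t - N t - m 0 with hJ
  have hJc : Continuous J := (hm.sub hNc).sub continuous_const
  have hae : ∀ᵐ t, t ∈ Ioo 0 b → J t = 0 := by
    refine isOpen_Ioo.ae_eq_zero_of_integral_contDiff_smul_eq_zero
      (hJc.locallyIntegrable.locallyIntegrableOn _) fun g hg hgc hgs => ?_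
    -- A point `c < b` to the right of the support of `g`. Inserting `b / 2` covers the case of
    -- empty support.
    obtain ⟨c, hc, hcmax⟩ := (hgc.isCompact.insert (b / 2)).exists_isMaxOn ⟨_, mem_insert _ _⟩
      continuous_id.continuousOn
    have hcb : 0 < c ∧ c < b := by
      rcases hc with rfl | hc
      · constructor <;> linarith
      · exact hgs hc
    have hg0 : ∀ t, c < t → g t = 0 := fun t ht => by
      by_contra h0
      have := hcmax (mem_insert_of_mem _ (subset_tsupport g h0))
      simp only [id_eq, mem_ofPred_eq] at this
      linarith
    have hg0' : ∀ t, t ≤ 0 → g t = 0 := fun t ht => by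
      by_contra h0
      have := (hgs (subset_tsupport g h0)).1
      linarith
    have hgcont := hg.continuous
    -- The primitive of `g` normalised to vanish for `t ≥ c`, so that it is admissible near `b`. On
    -- `t ≤ 0` it is the constant `-∫ g`, which produces the initial term `m 0` in `J`.
    set G : ℝ → ℝ := fun t => ∫ τ in c..t, g τ with hG
    have hGd : ∀ t, HasDerivAt G (g t) t := fun t =>
      (hgcont.integral_hasStrictDerivAt c t).hasDerivAt
    have hGs : ContDiff ℝ ∞ G := by
      rw [contDiff_infty_iff_deriv]
      refine ⟨fun t => (hGd t).differentiableAt, ?_⟩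
      rwa [show deriv G = g from funext fun t => (hGd t).deriv]
    have hG0 : ∀ t, c ≤ t → G t = 0 := fun t ht => by
      rw [hG]
      refine intervalIntegral.integral_zero_ae (Eventually.of_forall fun x hx => ?_)
      rw [uIoc_of_le ht] at hx
      exact hg0 x hx.1
    -- As `G` need not vanish on the negative axis, a cutoff equal to one on `[-b, b]` makes the
    -- support compact without changing anything on `[0, b]`.
    let χ : ContDiffBump (0 : ℝ) := ⟨b, b + 1, hb, by linarith⟩
    set η : ℝ → ℝ := fun t => χ t * G t with hη
    have hχ1 : ∀ t ∈ Icc (-b) b, χ t = 1 := fun t ht =>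
      χ.one_of_mem_closedBall (by
        rw [mem_closedBall_zero_iff, Real.norm_eq_abs]; exact abs_le.2 ht)
    have hηs : tsupport η ⊆ Iio b := by
      have h1 : tsupport η ⊆ Iic c := by
        refine closure_minimal (fun t ht => ?_) isClosed_Iic
        by_contra h2
        exact ht (by simp [hη, hG0 t (not_le.1 h2).le])
      exact h1.trans fun t ht => lt_of_le_of_lt ht hcb.2
    have key := h η (χ.contDiff.mul hGs) χ.hasCompactSupport.mul_right hηs
    have hηG : ∀ t ∈ Icc 0 b, η t = G t := fun t ht => by
      rw [hη]; simp only; rw [hχ1 t ⟨by linarith [ht.1], ht.2⟩, one_mul]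
    have hηd : ∀ t ∈ Ioo 0 b, deriv η t = g t := fun t ht => by
      rw [← (hGd t).deriv]
      refine Filter.EventuallyEq.deriv_eq ?_
      filter_upwards [Ioo_mem_nhds ht.1 ht.2] with x hx using hηG x ⟨hx.1.le, hx.2.le⟩
    have e1 : ∫ t in (0 : ℝ)..b, (deriv η t * m t + η t * n t)
        = ∫ t in (0 : ℝ)..b, (g t * m t + G t * n t) := by
      refine intervalIntegral.integral_congr_ae ?_
      have : ∀ᵐ t : ℝ, t ≠ b := by simp [ae_iff]
      filter_upwards [this] with t ht1 ht
      rw [uIoc_of_le hb.le] at ht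
      rw [hηd t ⟨ht.1, lt_of_le_of_ne ht.2 ht1⟩, hηG t ⟨ht.1.le, ht.2⟩]
    have hGc : Continuous G := hGs.continuous
    have e2 : ∫ t in (0 : ℝ)..b, G t * n t = - ∫ t in (0 : ℝ)..b, g t * N t := by
      rw [intervalIntegral.integral_mul_deriv_eq_deriv_mul (fun t _ => hGd t) (fun t _ => hNd t)
        (hgcont.intervalIntegrable _ _) (hn.intervalIntegrable _ _), hG0 b hcb.2.le]
      simp [hN]
    have e3 : G 0 = - ∫ t in (0 : ℝ)..b, g t := by
      rw [hG]
      simp only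
      rw [← intervalIntegral.integral_add_adjacent_intervals (hgcont.intervalIntegrable 0 c)
        (hgcont.intervalIntegrable c b), intervalIntegral.integral_symm 0 c]
      have : ∫ t in c..b, g t = 0 := hG0 b hcb.2.le
      rw [this, add_zero]
    have e6 : ∫ t in (0 : ℝ)..b, (g t * m t + G t * n t)
        = (∫ t in (0 : ℝ)..b, g t * m t) + ∫ t in (0 : ℝ)..b, G t * n t :=
      intervalIntegral.integral_add ((hgcont.mul hm).intervalIntegrable _ _)
        ((hGc.mul hn).intervalIntegrable _ _)
    rw [e1, e6, e2, hηG 0 ⟨le_rfl, hb.le⟩, e3] at key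
    have e4 : ∫ t, g t • J t = ∫ t in (0 : ℝ)..b, g t * J t := by
      rw [intervalIntegral.integral_of_le hb.le, ← integral_indicator measurableSet_Ioc]
      refine integral_congr_ae (Eventually.of_forall fun t => ?_)
      simp only [indicator, smul_eq_mul]
      split_ifs with ht
      · rfl
      · rw [mem_Ioc, not_and_or, not_lt, not_le] at ht
        rcases ht with ht | ht
        · rw [hg0' t ht, zero_mul]
        · rw [hg0 t (by linarith), zero_mul]
    rw [e4]
    have e5 : ∀ t, g t * J t = g t * m t - g t * N t - g t * m 0 := fun t => by rw [hJ]; ring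
    simp only [e5]
    have i1 := (hgcont.mul hm).intervalIntegrable (μ := volume) 0 b
    have i2 := (hgcont.mul hNc).intervalIntegrable (μ := volume) 0 b
    have i3 := (hgcont.mul (continuous_const (y := m 0))).intervalIntegrable (μ := volume) 0 b
    have e7 : ∫ t in (0 : ℝ)..b, (g t * m t - g t * N t - g t * m 0)
        = (∫ t in (0 : ℝ)..b, (g t * m t - g t * N t)) - ∫ t in (0 : ℝ)..b, g t * m 0 :=
      intervalIntegral.integral_sub (i1.sub i2) i3
    have e8 : ∫ t in (0 : ℝ)..b, (g t * m t - g t * N t)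
        = (∫ t in (0 : ℝ)..b, g t * m t) - ∫ t in (0 : ℝ)..b, g t * N t :=
      intervalIntegral.integral_sub i1 i2
    rw [e7, e8, intervalIntegral.integral_mul_const]
    linarith
  have hIoo : ∀ t ∈ Ioo 0 b, J t = 0 := by
    have h1 : J =ᵐ[volume.restrict (Ioo 0 b)] fun _ => (0 : ℝ) := by
      rw [EventuallyEq, ae_restrict_iff' measurableSet_Ioo]
      exact hae
    exact Measure.eqOn_open_of_ae_eq h1 isOpen_Ioo hJc.continuousOn continuousOn_const
  intro t ht
  have : J t = 0 := by
    have h2 : closure (Ioo 0 b) ⊆ {t | J t = 0} :=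
      closure_minimal hIoo (isClosed_eq hJc continuous_const)
    rw [closure_Ioo hb.ne] at h2
    exact h2 ht
  rw [hJ] at this
  simp only at this
  linarith

/-- On `[0, b]` with `t < b < T` the functions extend continuously to the line, the du Bois-Reymond
lemma makes `m` a primitive of `n` there, and the fundamental theorem of calculus applies. One-sided
derivatives include the initial time `t = 0`. -/
theorem hasDerivWithinAt_of_weak_deriv {m n : ℝ → ℝ} {T : ℝ} (hm : ContinuousOn m (Ico 0 T))
    (hn : ContinuousOn n (Ico 0 T))
    (h : ∀ η : ℝ → ℝ, ContDiff ℝ ∞ η → HasCompactSupport η → tsupport η ⊆ Iio T →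
      (∫ t in Ioo 0 T, (deriv η t * m t + η t * n t)) + η 0 * m 0 = 0) :
    ∀ t ∈ Ico 0 T, HasDerivWithinAt m (n t) (Ici t) t := by
  intro t ht
  obtain ⟨b, hb⟩ := exists_between ht.2
  have h0b : 0 < b := lt_of_le_of_lt ht.1 hb.1
  have hsub : Icc 0 b ⊆ Ico 0 T := fun x hx => ⟨hx.1, hx.2.trans_lt hb.2⟩
  set m' : ℝ → ℝ := IccExtend h0b.le ((Icc 0 b).domRestrict m) with hm'
  set n' : ℝ → ℝ := IccExtend h0b.le ((Icc 0 b).domRestrict n) with hn'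
  have hmc : Continuous m' := (continuousOn_iff_continuous_domRestrict.1 (hm.mono hsub)).Icc_extend'
  have hnc : Continuous n' := (continuousOn_iff_continuous_domRestrict.1 (hn.mono hsub)).Icc_extend'
  have hme : ∀ x ∈ Icc 0 b, m' x = m x := fun x hx => IccExtend_of_mem h0b.le _ hx
  have hne : ∀ x ∈ Icc 0 b, n' x = n x := fun x hx => IccExtend_of_mem h0b.le _ hx
  have key := eq_add_integral_of_weak_deriv h0b hmc hnc fun η hη hηc hηs => by
    refine Eq.trans ?_ (h η hη hηc (hηs.trans (Iio_subset_Iio hb.2.le)))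
    rw [hme 0 ⟨le_rfl, h0b.le⟩]
    congr 1
    rw [intervalIntegral.integral_of_le h0b.le]
    have e1 : ∫ t in Ioo 0 T, (deriv η t * m t + η t * n t)
        = ∫ t in Ioc 0 b, (deriv η t * m t + η t * n t) := by
      refine setIntegral_eq_of_subset_of_forall_sdiff_eq_zero measurableSet_Ioo
        (fun x hx => ⟨hx.1, hx.2.trans_lt hb.2⟩) fun x hx => ?_
      have hxb : x ∉ tsupport η := fun hx' => hx.2 ⟨hx.1.1, (hηs hx').le⟩
      have hxd : x ∉ tsupport (deriv η) := fun hx' => hxb (tsupport_deriv_subset hx')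
      rw [image_eq_zero_of_notMem_tsupport hxb, image_eq_zero_of_notMem_tsupport hxd]
      ring
    rw [e1]
    refine setIntegral_congr_fun measurableSet_Ioc fun x hx => ?_
    have hx' : x ∈ Icc 0 b := ⟨hx.1.le, hx.2⟩
    simp only [hme x hx', hne x hx']
  have hd : HasDerivAt (fun t => m' 0 + ∫ τ in (0 : ℝ)..t, n' τ) (n' t) t :=
    (hnc.integral_hasStrictDerivAt 0 t).hasDerivAt.const_add _
  rw [hne t ⟨ht.1, hb.1.le⟩] at hd
  refine hd.hasDerivWithinAt.congr_of_eventuallyEq ?_ ?_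
  · filter_upwards [Ico_mem_nhdsGE hb.1] with x hx
    have hx' : x ∈ Icc 0 b := ⟨ht.1.trans hx.1, hx.2.le⟩
    rw [← hme x hx', key x hx']
  · have hx' : t ∈ Icc 0 b := ⟨ht.1, hb.1.le⟩
    rw [← hme t hx', key t hx']

/-! ### Pairings of an Euler solution with a fixed test field -/

open scoped Classical in
theorem tendsto_integral_inner_of_tendsto_eLpNorm {α ι E : Type*} [MeasurableSpace α]
    {μ : Measure α} [NormedAddCommGroup E] [InnerProductSpace ℝ E] {l : Filter ι}
    {f g : ι → α → E} {f₀ g₀ : α → E} (hf : ∀ᶠ i in l, MemLp (f i) 2 μ)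
    (hg : ∀ᶠ i in l, MemLp (g i) 2 μ) (hf₀ : MemLp f₀ 2 μ) (hg₀ : MemLp g₀ 2 μ)
    (hlf : Tendsto (fun i => eLpNorm (f i - f₀) 2 μ) l (𝓝 0))
    (hlg : Tendsto (fun i => eLpNorm (g i - g₀) 2 μ) l (𝓝 0)) :
    Tendsto (fun i => ∫ x, inner ℝ (f i x) (g i x) ∂μ) l (𝓝 (∫ x, inner ℝ (f₀ x) (g₀ x) ∂μ)) := by
  have aux : ∀ {f : ι → α → E} {f₀ : α → E}, (∀ᶠ i in l, MemLp (f i) 2 μ) → ∀ hf₀ : MemLp f₀ 2 μ,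
      Tendsto (fun i => eLpNorm (f i - f₀) 2 μ) l (𝓝 0) →
      Tendsto (fun i => if h : MemLp (f i) 2 μ then h.toLp (f i) else 0) l (𝓝 (hf₀.toLp f₀)) := by
    intro f f₀ hf hf₀ hlf
    rw [tendsto_iff_norm_sub_tendsto_zero]
    have h1 := (ENNReal.continuousAt_toReal ENNReal.zero_ne_top).tendsto.comp hlf
    rw [ENNReal.toReal_zero] at h1
    refine h1.congr' ?_
    filter_upwards [hf] with i hi
    rw [dif_pos hi, ← MemLp.toLp_sub, Lp.norm_toLp]
    rfl
  have hinner : ∀ {f g : α → E} (hf : MemLp f 2 μ) (hg : MemLp g 2 μ),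
      inner ℝ (hf.toLp f) (hg.toLp g) = ∫ x, inner ℝ (f x) (g x) ∂μ := by
    intro f g hf hg
    rw [L2.inner_def]
    refine integral_congr_ae ?_
    filter_upwards [hf.coeFn_toLp, hg.coeFn_toLp] with x h1 h2
    rw [h1, h2]
  have key := (aux hf hf₀ hlf).inner (𝕜 := ℝ) (aux hg hg₀ hlg)
  rw [hinner hf₀ hg₀] at key
  refine key.congr' ?_
  filter_upwards [hf, hg] with i h1 h2
  rw [dif_pos h1, dif_pos h2, hinner]

theorem integrable_inner_of_memLp_two {α E : Type*} [MeasurableSpace α] {μ : Measure α}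
    [NormedAddCommGroup E] [InnerProductSpace ℝ E] {f g : α → E} (hf : MemLp f 2 μ)
    (hg : MemLp g 2 μ) : Integrable (fun x => inner ℝ (f x) (g x)) μ := by
  refine (L2.integrable_inner (𝕜 := ℝ) (hf.toLp f) (hg.toLp g)).congr ?_
  filter_upwards [hf.coeFn_toLp, hg.coeFn_toLp] with x h1 h2
  rw [h1, h2]

section TimeDerivative

variable {p T : ℝ} {u : ℝ → Plane → Plane} {G : ℝ → Plane → Plane →L[ℝ] Plane}

theorem two_le_ofReal (hp : 2 ≤ p) : (2 : ℝ≥0∞) ≤ ENNReal.ofReal p := by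
  rw [← ENNReal.ofReal_ofNat]
  exact ENNReal.ofReal_le_ofReal hp

theorem MeasureTheory.MemLp.restrict_two {E : Type*} [NormedAddCommGroup E] {f : Plane → E}
    (hp : 2 ≤ p) (hf : MemLp f (ENNReal.ofReal p)) {K : Set Plane} (hK : IsCompact K) :
    MemLp f 2 (volume.restrict K) := by
  have : IsFiniteMeasure (volume.restrict K) := ⟨by simpa using hK.measure_lt_top⟩
  exact (hf.restrict K).mono_exponent (two_le_ofReal hp)

/-- Each solution is only in `L^p`, but pairings with test fields see a compact set, where `p ≥ 2`
lets `L^p` convergence imply `L²` convergence. -/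
theorem IsContinuousW1p.tendsto_restrict (hp : 2 ≤ p) (hreg : IsContinuousW1p p T u G)
    {K : Set Plane} (hK : IsCompact K) {t : ℝ} (ht : t ∈ Ico 0 T) :
    Tendsto (fun τ => eLpNorm (u τ - u t) 2 (volume.restrict K)) (𝓝[Ico 0 T] t) (𝓝 0) := by
  have hfin : IsFiniteMeasure (volume.restrict K) := ⟨by simpa using hK.measure_lt_top⟩
  have h1 : Tendsto (fun τ => eLpNorm (u τ - u t) (ENNReal.ofReal p)) (𝓝[Ico 0 T] t) (𝓝 0) :=
    tendsto_of_tendsto_of_tendsto_of_le_of_le tendsto_const_nhds (hreg.continuous t ht)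
      (fun _ => zero_le) fun _ => le_self_add
  set c : ℝ≥0∞ := (volume.restrict K) univ ^ (1 / (2 : ℝ≥0∞).toReal - 1 / (ENNReal.ofReal p).toReal) with hc
  have hct : c ≠ ⊤ := by
    refine ENNReal.rpow_ne_top_of_nonneg ?_ (measure_ne_top _ _)
    rw [ENNReal.toReal_ofReal (by linarith), ENNReal.toReal_ofNat, sub_nonneg]
    exact one_div_le_one_div_of_le (by norm_num) hp
  have h2 := ENNReal.Tendsto.mul_const h1 (Or.inr hct)
  rw [zero_mul] at h2
  refine tendsto_of_tendsto_of_tendsto_of_le_of_le' tendsto_const_nhds h2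
    (Eventually.of_forall fun _ => zero_le) ?_
  filter_upwards [self_mem_nhdsWithin] with τ hτ
  refine (eLpNorm_le_eLpNorm_mul_rpow_measure_univ (two_le_ofReal hp)
    ((hreg.memLp τ hτ).1.sub (hreg.memLp t ht).1).restrict).trans ?_
  exact mul_le_mul' (eLpNorm_mono_measure (u τ - u t) Measure.restrict_le_self) le_rfl

theorem IsDivFreeTest.exists_bound_fderiv {φ : Plane → Plane} (hφ : IsDivFreeTest φ) :
    ∃ C : ℝ, 0 ≤ C ∧ ∀ x, ‖fderiv ℝ φ x‖ ≤ C := by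
  obtain ⟨C, hC⟩ := (hφ.contDiff.continuous_fderiv (by simp)).bounded_above_of_compact_support
    (hφ.hasCompactSupport.fderiv ℝ)
  exact ⟨C, (norm_nonneg _).trans (hC 0), hC⟩

theorem memLp_clm_apply {α : Type*} [MeasurableSpace α] {μ : Measure α} {q : ℝ≥0∞}
    {A : α → Plane →L[ℝ] Plane} {f : α → Plane} {C : ℝ} (hA : AEStronglyMeasurable A μ)
    (hC : ∀ x, ‖A x‖ ≤ C) (hf : MemLp f q μ) : MemLp (fun x => A x (f x)) q μ := by
  refine hf.of_le_mul (c := C) ?_ (Eventually.of_forall fun x => ?_)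
  · exact (ContinuousLinearMap.apply ℝ Plane).flip.aestronglyMeasurable_comp₂ hA hf.1
  · exact (A x).le_of_opNorm_le (hC x) _

theorem eLpNorm_clm_apply_le {α : Type*} [MeasurableSpace α] {μ : Measure α} {q : ℝ≥0∞}
    {A : α → Plane →L[ℝ] Plane} {f : α → Plane} {C : ℝ}
    (hC : ∀ x, ‖A x‖ ≤ C) : eLpNorm (fun x => A x (f x)) q μ ≤ ENNReal.ofReal C * eLpNorm f q μ :=
  eLpNorm_le_mul_eLpNorm_of_ae_le_mul
    (Eventually.of_forall fun x => (A x).le_of_opNorm_le (hC x) _) q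

theorem setIntegral_tsupport_inner (φ v : Plane → Plane) :
    ∫ x in tsupport φ, inner ℝ (v x) (φ x) = ∫ x, inner ℝ (v x) (φ x) := by
  refine setIntegral_eq_integral_of_forall_compl_eq_zero fun x hx => ?_
  rw [image_eq_zero_of_notMem_tsupport hx, inner_zero_right]

theorem setIntegral_tsupport_inner_fderiv (φ v : Plane → Plane) :
    ∫ x in tsupport φ, inner ℝ (v x) (fderiv ℝ φ x (v x))
      = ∫ x, inner ℝ (v x) (fderiv ℝ φ x (v x)) := by
  refine setIntegral_eq_integral_of_forall_compl_eq_zero fun x hx => ?_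
  rw [image_eq_zero_of_notMem_tsupport fun h => hx (tsupport_fderiv_subset ℝ h)]
  simp

theorem IsDivFreeTest.integrable_inner {φ v : Plane → Plane} (hφ : IsDivFreeTest φ) (hp : 2 ≤ p)
    (hv : MemLp v (ENNReal.ofReal p)) : Integrable fun x => inner ℝ (v x) (φ x) := by
  rw [← integrableOn_iff_integrable_of_support_subset (s := tsupport φ)]
  · exact integrable_inner_of_memLp_two (hv.restrict_two hp hφ.hasCompactSupport) ((hφ.memLp 2).restrict _)
  · intro x hx
    by_contra h
    exact hx (by simp [image_eq_zero_of_notMem_tsupport h])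

theorem IsDivFreeTest.integrable_inner_fderiv {φ v v' : Plane → Plane} (hφ : IsDivFreeTest φ)
    (hp : 2 ≤ p) (hv : MemLp v (ENNReal.ofReal p)) (hv' : MemLp v' (ENNReal.ofReal p)) :
    Integrable fun x => inner ℝ (v x) (fderiv ℝ φ x (v' x)) := by
  obtain ⟨C, hC0, hC⟩ := hφ.exists_bound_fderiv
  rw [← integrableOn_iff_integrable_of_support_subset (s := tsupport φ)]
  · exact integrable_inner_of_memLp_two (hv.restrict_two hp hφ.hasCompactSupport)
      (memLp_clm_apply (hφ.contDiff.continuous_fderiv (by simp)).aestronglyMeasurable hC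
        (hv'.restrict_two hp hφ.hasCompactSupport))
  · intro x hx
    by_contra h
    refine hx ?_
    simp only
    rw [image_eq_zero_of_notMem_tsupport fun h' => h (tsupport_fderiv_subset ℝ h')]
    simp

theorem IsContinuousW1p.continuousOn_integral_inner (hp : 2 ≤ p) (hreg : IsContinuousW1p p T u G)
    {φ : Plane → Plane} (hφ : IsDivFreeTest φ) :
    ContinuousOn (fun t => ∫ x, inner ℝ (u t x) (φ x)) (Ico 0 T) := by
  intro t ht
  simp only [ContinuousWithinAt, ← setIntegral_tsupport_inner φ]
  have hK : IsCompact (tsupport φ) := hφ.hasCompactSupport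
  refine tendsto_integral_inner_of_tendsto_eLpNorm ?_
    (Eventually.of_forall fun _ => (hφ.memLp 2).restrict _) ((hreg.memLp t ht).restrict_two hp hK)
    ((hφ.memLp 2).restrict _) (hreg.tendsto_restrict hp hK ht) ?_
  · filter_upwards [self_mem_nhdsWithin] with τ hτ using (hreg.memLp τ hτ).restrict_two hp hK
  · simpa using tendsto_const_nhds

theorem IsContinuousW1p.continuousOn_integral_inner_fderiv (hp : 2 ≤ p)
    (hreg : IsContinuousW1p p T u G) {φ : Plane → Plane} (hφ : IsDivFreeTest φ) :
    ContinuousOn (fun t => ∫ x, inner ℝ (u t x) (fderiv ℝ φ x (u t x))) (Ico 0 T) := by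
  intro t ht
  simp only [ContinuousWithinAt, ← setIntegral_tsupport_inner_fderiv φ]
  have hK : IsCompact (tsupport φ) := hφ.hasCompactSupport
  obtain ⟨C, hC0, hC⟩ := hφ.exists_bound_fderiv
  have hm : AEStronglyMeasurable (fderiv ℝ φ) (volume.restrict (tsupport φ)) :=
    (hφ.contDiff.continuous_fderiv (by simp)).aestronglyMeasurable
  have hu := fun τ (hτ : τ ∈ Ico 0 T) => (hreg.memLp τ hτ).restrict_two hp hK
  refine tendsto_integral_inner_of_tendsto_eLpNorm ?_ ?_ (hu t ht) (memLp_clm_apply hm hC (hu t ht))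
    (hreg.tendsto_restrict hp hK ht) ?_
  · filter_upwards [self_mem_nhdsWithin] with τ hτ using hu τ hτ
  · filter_upwards [self_mem_nhdsWithin] with τ hτ using memLp_clm_apply hm hC (hu τ hτ)
  · have h := ENNReal.Tendsto.const_mul (hreg.tendsto_restrict hp hK ht)
      (Or.inr (ENNReal.ofReal_ne_top (r := C)))
    rw [mul_zero] at h
    refine tendsto_of_tendsto_of_tendsto_of_le_of_le tendsto_const_nhds h (fun _ => zero_le)
      fun τ => ?_
    refine le_trans (le_of_eq ?_) (eLpNorm_clm_apply_le (f := u τ - u t) hC)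
    congr 1
    ext1 x
    simp

/-- For a fixed divergence-free test field `φ`, the pairing of an Euler solution with `φ` is
right differentiable in time. -/
theorem IsWeakEulerSolution.hasDerivWithinAt_integral_inner (hp : 2 ≤ p)
    (hreg : IsContinuousW1p p T u G) (he : IsWeakEulerSolution T u) {φ : Plane → Plane}
    (hφ : IsDivFreeTest φ) : ∀ t ∈ Ico 0 T,
    HasDerivWithinAt (fun t => ∫ x, inner ℝ (u t x) (φ x))
      (∫ x, inner ℝ (u t x) (fderiv ℝ φ x (u t x))) (Ici t) t := by
  refine hasDerivWithinAt_of_weak_deriv (hreg.continuousOn_integral_inner hp hφ)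
    (hreg.continuousOn_integral_inner_fderiv hp hφ) fun η hη hηc hηs => ?_
  have hφd : Differentiable ℝ φ := hφ.contDiff.differentiable (by simp)
  have hηd : Differentiable ℝ η := hη.differentiable (by simp)
  have hsub : tsupport (Function.uncurry fun (t : ℝ) (x : Plane) => η t • φ x)
      ⊆ tsupport η ×ˢ tsupport φ := by
    refine closure_minimal ?_ ((isClosed_tsupport _).prod (isClosed_tsupport _))
    rintro ⟨t, x⟩ h
    simp only [Function.mem_support, Function.uncurry_apply_pair, ne_eq, smul_eq_zero, not_or] at h
    exact ⟨subset_tsupport _ h.1, subset_tsupport _ h.2⟩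
  have hfd : ∀ (c : ℝ) x, fderiv ℝ (fun x => c • φ x) x = c • fderiv ℝ φ x := fun c x =>
    fderiv_fun_const_smul (hφd x) c
  -- The separated test field `η(t) φ(x)` turns the momentum equation into the weak form of a scalar
  -- ODE for the pairing with `φ`.
  have key := he.momentum (fun t x => η t • φ x) ?_ ?_ ?_ ?_
  · refine Eq.trans ?_ key
    congr 1
    · refine setIntegral_congr_fun measurableSet_Ioo fun t ht => ?_
      have htI : t ∈ Ico 0 T := ⟨ht.1.le, ht.2⟩
      rw [← integral_const_mul, ← integral_const_mul, ← integral_add]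
      · refine integral_congr_ae (Eventually.of_forall fun x => ?_)
        simp only
        rw [hfd, deriv_smul_const (hηd t)]
        simp [inner_smul_right]
      · exact (hφ.integrable_inner hp (hreg.memLp t htI)).const_mul _
      · exact (hφ.integrable_inner_fderiv hp (hreg.memLp t htI) (hreg.memLp t htI)).const_mul _
    · rw [← integral_const_mul]
      simp [inner_smul_right]
  · exact (hη.comp contDiff_fst).smul (hφ.contDiff.comp contDiff_snd)
  · exact HasCompactSupport.of_support_subset_isCompact
      (IsCompact.prod hηc hφ.hasCompactSupport) ((subset_tsupport _).trans hsub)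
  · exact hsub.trans (prod_mono hηs (subset_univ _))
  · intro t x
    have := hφ.divergence x
    simp only [divergenceAt, hfd] at this ⊢
    simp only [smul_apply, PiLp.smul_apply, smul_eq_mul]
    rw [← Finset.mul_sum, this, mul_zero]

end TimeDerivative

/-! ### Integration by parts in the nonlinear terms -/

theorem hasFDerivAt_coord {v : Plane → Plane} (hv : Differentiable ℝ v) (i : Fin 2) (x e : Plane) :
    fderiv ℝ (fun y => v y i) x e = (fderiv ℝ v x e) i := by
  have h : fderiv ℝ (fun y => v y i) x = (EuclideanSpace.proj (𝕜 := ℝ) i).comp (fderiv ℝ v x) :=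
    ((EuclideanSpace.proj (𝕜 := ℝ) i).hasFDerivAt.comp x (hv x).hasFDerivAt).fderiv
  rw [h]
  rfl

theorem LocallyIntegrable.integrable_inner_of_hasCompactSupport {f Φ : Plane → Plane}
    (hf : LocallyIntegrable f) (hΦ : Continuous Φ) (hc : HasCompactSupport Φ) :
    Integrable fun x => inner ℝ (f x) (Φ x) := by
  have h : ∀ i : Fin 2, Integrable fun x => Φ x i * f x i := by
    intro i
    have h1 : Integrable fun x => Φ x i • f x := by
      refine hf.integrable_smul_left_of_hasCompactSupport (by fun_prop) ?_
      exact hc.comp_left (g := fun z : Plane => z i) rfl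
    simpa using (EuclideanSpace.proj (𝕜 := ℝ) i).integrable_comp h1
  refine ((h 0).add (h 1)).congr (Eventually.of_forall fun x => ?_)
  simp [PiLp.inner_apply, Fin.sum_univ_two]

theorem HasWeakGradient.integral_inner_fderiv {u : Plane → Plane} {G : Plane → Plane →L[ℝ] Plane}
    (h : HasWeakGradient u G) {Φ : Plane → Plane} (hΦ : ContDiff ℝ ∞ Φ) (hc : HasCompactSupport Φ)
    (e : Plane) :
    ∫ x, inner ℝ (u x) (fderiv ℝ Φ x e) = - ∫ x, inner ℝ (G x e) (Φ x) := by
  obtain ⟨hu, hG, hw⟩ := h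
  have hGe : LocallyIntegrable fun x => G x e := by
    intro x
    obtain ⟨s, hs, hi⟩ := hG x
    exact ⟨s, hs, (ContinuousLinearMap.apply ℝ Plane e).integrable_comp hi⟩
  have hΦd : Differentiable ℝ Φ := hΦ.differentiable (by simp)
  have hΦi : ∀ i : Fin 2, ContDiff ℝ ∞ fun x => Φ x i := contDiff_euclidean.1 hΦ
  have hci : ∀ i : Fin 2, HasCompactSupport fun x => Φ x i := fun i =>
    hc.comp_left (g := fun z : Plane => z i) rfl
  have i1 : ∀ i : Fin 2, Integrable fun x => fderiv ℝ (fun y => Φ y i) x e • u x := fun i =>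
    hu.integrable_smul_left_of_hasCompactSupport
      (((hΦi i).continuous_fderiv (by simp)).clm_apply continuous_const)
      ((hci i).fderiv_apply (𝕜 := ℝ) e)
  have i2 : ∀ i : Fin 2, Integrable fun x => Φ x i • G x e := fun i =>
    hGe.integrable_smul_left_of_hasCompactSupport (hΦi i).continuous (hci i)
  have key : ∀ i : Fin 2, ∫ x, (fderiv ℝ Φ x e) i * u x i = - ∫ x, Φ x i * (G x e) i := by
    intro i
    have h1 := congrArg (EuclideanSpace.proj (𝕜 := ℝ) i) (hw _ (hΦi i) (hci i) e)
    rw [map_neg, ← ContinuousLinearMap.integral_comp_comm _ (i1 i),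
      ← ContinuousLinearMap.integral_comp_comm _ (i2 i)] at h1
    simpa [hasFDerivAt_coord hΦd] using h1
  have j1 : ∀ i : Fin 2, Integrable fun x => (fderiv ℝ Φ x e) i * u x i := fun i => by
    simpa [hasFDerivAt_coord hΦd] using (EuclideanSpace.proj (𝕜 := ℝ) i).integrable_comp (i1 i)
  have j2 : ∀ i : Fin 2, Integrable fun x => Φ x i * (G x e) i := fun i => by
    simpa using (EuclideanSpace.proj (𝕜 := ℝ) i).integrable_comp (i2 i)
  have e1 : ∀ x, inner ℝ (u x) (fderiv ℝ Φ x e)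
      = (fderiv ℝ Φ x e) 0 * u x 0 + (fderiv ℝ Φ x e) 1 * u x 1 := fun x => by
    simp [PiLp.inner_apply, Fin.sum_univ_two]
  have e2 : ∀ x, inner ℝ (G x e) (Φ x) = Φ x 0 * (G x e) 0 + Φ x 1 * (G x e) 1 := fun x => by
    simp [PiLp.inner_apply, Fin.sum_univ_two]
  simp only [e1, e2]
  rw [integral_add (j1 0) (j1 1), integral_add (j2 0) (j2 1), key, key]
  ring

/-- Integration by parts against the weak gradient, transported by a smooth divergence-free
field. -/
theorem HasWeakGradient.integral_inner_fderiv_apply {u : Plane → Plane}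
    {G : Plane → Plane →L[ℝ] Plane} (h : HasWeakGradient u G) {v φ : Plane → Plane}
    (hv : ContDiff ℝ ∞ v) (hdiv : ∀ x, divergenceAt v x = 0) (hφ : IsDivFreeTest φ) :
    ∫ x, inner ℝ (u x) (fderiv ℝ φ x (v x)) = - ∫ x, inner ℝ (G x (v x)) (φ x) := by
  have hvd : Differentiable ℝ v := hv.differentiable (by simp)
  have hφd : Differentiable ℝ φ := hφ.contDiff.differentiable (by simp)
  have hvi : ∀ i : Fin 2, ContDiff ℝ ∞ fun x => v x i := contDiff_euclidean.1 hv
  have hΦ : ∀ j : Fin 2, ContDiff ℝ ∞ fun x => v x j • φ x := fun j => (hvi j).smul hφ.contDiff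
  have hc : ∀ j : Fin 2, HasCompactSupport fun x => v x j • φ x := fun j =>
    hφ.hasCompactSupport.smul_left (f := fun x => v x j)
  have hd : ∀ (j : Fin 2) x e, fderiv ℝ (fun x => v x j • φ x) x e
      = v x j • fderiv ℝ φ x e + (fderiv ℝ v x e) j • φ x := by
    intro j x e
    rw [fderiv_fun_smul ((hvi j).differentiable (by simp) x) (hφd x)]
    simp [hasFDerivAt_coord hvd]
  have i1 : ∀ j : Fin 2, Integrable fun x => inner ℝ (u x)
      (fderiv ℝ (fun x => v x j • φ x) x (EuclideanSpace.single j 1)) := fun j =>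
    LocallyIntegrable.integrable_inner_of_hasCompactSupport h.1
      (((hΦ j).continuous_fderiv (by simp)).clm_apply continuous_const)
      ((hc j).fderiv_apply (𝕜 := ℝ) _)
  have hGe : ∀ e : Plane, LocallyIntegrable fun x => G x e := by
    intro e x
    obtain ⟨s, hs, hi⟩ := h.2.1 x
    exact ⟨s, hs, (ContinuousLinearMap.apply ℝ Plane e).integrable_comp hi⟩
  have i2 : ∀ j : Fin 2, Integrable fun x => inner ℝ (G x (EuclideanSpace.single j 1))
      (v x j • φ x) := fun j =>
    LocallyIntegrable.integrable_inner_of_hasCompactSupport (hGe _) (hΦ j).continuous (hc j)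
  -- Since `div v = 0`, the derivative `(v·∇)φ` is in divergence form, `∑ⱼ ∂ⱼ(vⱼ φ)`, and each `vⱼ
  -- φ` can be tested against the weak gradient.
  have e1 : ∀ x, inner ℝ (u x) (fderiv ℝ φ x (v x))
      = inner ℝ (u x) (fderiv ℝ (fun x => v x 0 • φ x) x (EuclideanSpace.single 0 1))
      + inner ℝ (u x) (fderiv ℝ (fun x => v x 1 • φ x) x (EuclideanSpace.single 1 1)) := by
    intro x
    have h0 := hdiv x
    rw [divergenceAt, Fin.sum_univ_two] at h0
    rw [hd, hd, clm_plane_apply (fderiv ℝ φ x), ← inner_add_right]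
    congr 1
    rw [eq_neg_of_add_eq_zero_right h0, neg_smul]
    abel
  have e2 : ∀ x, inner ℝ (G x (v x)) (φ x)
      = inner ℝ (G x (EuclideanSpace.single 0 1)) (v x 0 • φ x)
      + inner ℝ (G x (EuclideanSpace.single 1 1)) (v x 1 • φ x) := by
    intro x
    rw [clm_plane_apply (G x), inner_add_left, inner_smul_left, inner_smul_left, inner_smul_right,
      inner_smul_right]
    simp only [conj_trivial]
  simp only [e1, e2]
  rw [integral_add (i1 0) (i1 1), integral_add (i2 0) (i2 1),
    h.integral_inner_fderiv (hΦ 0) (hc 0), h.integral_inner_fderiv (hΦ 1) (hc 1)]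
  ring

/-- As `p / 2 ≥ 1`, `‖a‖ ≤ 1 + ‖a‖^(p/2)`, and `‖a‖^(p/2)` is in `L²` when `a` is in `L^p`. Thus an
`L^p` function times a bounded `L²` function is in `L²`; only finiteness of this bound matters
later. -/
theorem eLpNorm_two_le_of_norm_le_mul {α E F₁ F₂ : Type*} [MeasurableSpace α] {μ : Measure α}
    [NormedAddCommGroup E] [NormedAddCommGroup F₁] [NormedAddCommGroup F₂] {p M : ℝ} (hp : 2 ≤ p)
    (hM : 0 ≤ M) {h : α → E} {a : α → F₁} {b : α → F₂} (ha : AEStronglyMeasurable a μ)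
    (hb : AEStronglyMeasurable b μ) (hle : ∀ x, ‖h x‖ ≤ ‖a x‖ * ‖b x‖) (hbM : ∀ x, ‖b x‖ ≤ M) :
    eLpNorm h 2 μ ≤ eLpNorm b 2 μ
      + ENNReal.ofReal M * eLpNorm a (ENNReal.ofReal p) μ ^ (p / 2) := by
  have h1 : eLpNorm (fun x => ‖a x‖ ^ (p / 2)) 2 μ = eLpNorm a (ENNReal.ofReal p) μ ^ (p / 2) := by
    rw [eLpNorm_norm_rpow _ (by linarith)]
    congr 2
    rw [← ENNReal.ofReal_ofNat, ← ENNReal.ofReal_mul (by norm_num)]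
    congr 1
    ring
  have h2 := eLpNorm_le_of_norm_le_add (h := h) (f := b) (g := fun x => ‖a x‖ ^ (p / 2)) (μ := μ)
    (p := 2) zero_le_one hM hb (ha.norm.aemeasurable.pow_const _).aestronglyMeasurable
    (by norm_num) fun x => by
      refine (hle x).trans ?_
      have h3 : ‖a x‖ ≤ 1 + ‖a x‖ ^ (p / 2) := by
        rcases le_or_gt ‖a x‖ 1 with h | h
        · have : 0 ≤ ‖a x‖ ^ (p / 2) := by positivity
          linarith
        · have := Real.self_le_rpow_of_one_le h.le (by linarith : 1 ≤ p / 2)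
          linarith
      rw [Real.norm_of_nonneg (by positivity : 0 ≤ ‖a x‖ ^ (p / 2))]
      calc ‖a x‖ * ‖b x‖ ≤ (1 + ‖a x‖ ^ (p / 2)) * ‖b x‖ := by gcongr
        _ = 1 * ‖b x‖ + ‖b x‖ * ‖a x‖ ^ (p / 2) := by ring
        _ ≤ _ := by gcongr; exact hbM x
  rwa [ENNReal.ofReal_one, one_mul, h1] at h2

/-- Hölder with exponents `p` and `q = p / (p - 1)`, after `‖v‖^(2q) ≤ S^(2q-2) ‖v‖²`. The exponents
become `(2q - 2) / q = 2 / p` on the sup norm and `2 / q = 2 - 2 / p` on the `L²` norm. -/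
theorem abs_integral_inner_clm_le {p S : ℝ} (hp : 2 ≤ p) {A : Plane → Plane →L[ℝ] Plane}
    {v : Plane → Plane} (hA : MemLp A (ENNReal.ofReal p)) (hv : MemLp v 2)
    (hS : ∀ x, ‖v x‖ ≤ S) :
    |∫ x, inner ℝ (A x (v x)) (v x)|
      ≤ (eLpNorm A (ENNReal.ofReal p)).toReal * S ^ (2 / p) * l2Norm v ^ (2 - 2 / p) := by
  have hp0 : 0 < p := by linarith
  have hS0 : 0 ≤ S := (norm_nonneg _).trans (hS 0)
  set q : ℝ := p / (p - 1) with hq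
  have hpq : p.HolderConjugate q := Real.HolderConjugate.conjExponent (by linarith)
  have hq0 : 0 < q := hpq.symm.pos
  have hq1 : 1 < q := hpq.symm.lt
  have hint2 : Integrable fun x => ‖v x‖ ^ 2 := (memLp_two_iff_integrable_sq_norm hv.1).1 hv
  have hpow : ∀ x, (‖v x‖ ^ 2) ^ q ≤ S ^ (2 * q - 2) * ‖v x‖ ^ 2 := by
    intro x
    have h1 : (‖v x‖ ^ 2) ^ q = ‖v x‖ ^ (2 * q - 2) * ‖v x‖ ^ (2 : ℝ) := by
      rw [← Real.rpow_two, ← Real.rpow_mul (norm_nonneg _), ← Real.rpow_add_of_nonneg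
        (norm_nonneg _) (by linarith) (by norm_num)]
      congr 1
      ring
    rw [h1, Real.rpow_two]
    gcongr
    · linarith
    · exact hS x
  have hgm : AEStronglyMeasurable (fun x => ‖v x‖ ^ 2) := hv.1.norm.pow 2
  have hintq : Integrable fun x => (‖v x‖ ^ 2) ^ q := by
    refine (hint2.const_mul (S ^ (2 * q - 2))).mono' ?_ ?_
    · exact (hgm.aemeasurable.pow_const q).aestronglyMeasurable
    · exact Eventually.of_forall fun x => by
        rw [Real.norm_of_nonneg (by positivity)]; exact hpow x
  have hgq : MemLp (fun x => ‖v x‖ ^ 2) (ENNReal.ofReal q) := by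
    rw [← integrable_norm_rpow_iff hgm (by simpa using hq0) ENNReal.ofReal_ne_top,
      ENNReal.toReal_ofReal hq0.le]
    simpa using hintq
  have hholder := integral_mul_le_Lp_mul_Lq_of_nonneg hpq (μ := volume)
    (f := fun x => ‖A x‖) (g := fun x => ‖v x‖ ^ 2) (Eventually.of_forall fun x => norm_nonneg _)
    (Eventually.of_forall fun x => by positivity) hA.norm hgq
  have hAi : Integrable fun x => ‖A x‖ * ‖v x‖ ^ 2 := by
    have : ENNReal.HolderTriple (ENNReal.ofReal p) (ENNReal.ofReal q) 1 := by
      have := hpq.ennrealOfReal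
      infer_instance
    exact MemLp.integrable_mul hA.norm hgq
  have hAn : (∫ x, ‖A x‖ ^ p) ^ (1 / p) = (eLpNorm A (ENNReal.ofReal p)).toReal := by
    rw [hA.eLpNorm_eq_integral_rpow_norm (by simpa using hp0) ENNReal.ofReal_ne_top,
      ENNReal.toReal_ofReal hp0.le, ENNReal.toReal_ofReal (by positivity), one_div]
  have hD : ∫ x, ‖v x‖ ^ 2 = l2Norm v ^ 2 := by
    rw [l2Norm, hv.eLpNorm_eq_integral_rpow_norm (by norm_num) (by norm_num),
      ENNReal.toReal_ofReal (by positivity), ← Real.rpow_natCast, ← Real.rpow_mul (by positivity)]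
    simp
  have hD0 : 0 ≤ l2Norm v := ENNReal.toReal_nonneg
  have hg2 : (∫ x, (‖v x‖ ^ 2) ^ q) ^ (1 / q) ≤ S ^ (2 / p) * l2Norm v ^ (2 - 2 / p) := by
    have h1 : ∫ x, (‖v x‖ ^ 2) ^ q ≤ S ^ (2 * q - 2) * l2Norm v ^ 2 := by
      rw [← hD, ← integral_const_mul]
      exact integral_mono hintq (hint2.const_mul _) hpow
    calc _ ≤ (S ^ (2 * q - 2) * l2Norm v ^ 2) ^ (1 / q) := by
          refine Real.rpow_le_rpow (integral_nonneg fun x => by positivity) h1 (by positivity)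
      _ = _ := by
        rw [Real.mul_rpow (by positivity) (by positivity), ← Real.rpow_mul hS0, ← Real.rpow_two,
          ← Real.rpow_mul hD0]
        have : p - 1 ≠ 0 := by linarith [hp] |> fun h : 0 < p - 1 => h.ne'
        congr 2
        · rw [hq]; field_simp; ring
        · rw [hq]; field_simp
  calc |∫ x, inner ℝ (A x (v x)) (v x)| ≤ ∫ x, ‖A x‖ * ‖v x‖ ^ 2 := by
        rw [← Real.norm_eq_abs]
        refine norm_integral_le_of_norm_le hAi (Eventually.of_forall fun x => ?_)
        refine (norm_inner_le_norm _ _).trans ?_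
        rw [sq, ← mul_assoc]
        gcongr
        exact (A x).le_opNorm _
    _ ≤ _ := hholder
    _ ≤ _ := by
      rw [hAn, mul_assoc]
      gcongr

theorem memLp_two_clm_apply {p M : ℝ} (hp : 2 ≤ p) {A : Plane → Plane →L[ℝ] Plane}
    {v : Plane → Plane} (hA : MemLp A (ENNReal.ofReal p)) (hv : MemLp v 2)
    (hM : ∀ x, ‖v x‖ ≤ M) : MemLp (fun x => A x (v x)) 2 ∧
      eLpNorm (fun x => A x (v x)) 2
        ≤ eLpNorm v 2 + ENNReal.ofReal M * eLpNorm A (ENNReal.ofReal p) ^ (p / 2) := by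
  have h1 := eLpNorm_two_le_of_norm_le_mul hp ((norm_nonneg _).trans (hM 0)) hA.1 hv.1
    (h := fun x => A x (v x)) (fun x => (A x).le_opNorm _) hM
  refine ⟨⟨?_, h1.trans_lt ?_⟩, h1⟩
  · exact (ContinuousLinearMap.apply ℝ Plane).flip.aestronglyMeasurable_comp₂ hA.1 hv.1
  · exact ENNReal.add_lt_top.2 ⟨hv.2, ENNReal.mul_lt_top ENNReal.ofReal_lt_top
      (ENNReal.rpow_lt_top_of_nonneg (by linarith) hA.2.ne)⟩

theorem memLp_two_clm_apply' {p M : ℝ} (hp : 2 ≤ p) {A : Plane → Plane →L[ℝ] Plane}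
    {v : Plane → Plane} (hA : MemLp A 2) (hv : MemLp v (ENNReal.ofReal p))
    (hM : ∀ x, ‖A x‖ ≤ M) : MemLp (fun x => A x (v x)) 2 ∧
      eLpNorm (fun x => A x (v x)) 2
        ≤ eLpNorm A 2 + ENNReal.ofReal M * eLpNorm v (ENNReal.ofReal p) ^ (p / 2) := by
  have h1 := eLpNorm_two_le_of_norm_le_mul hp ((norm_nonneg _).trans (hM 0)) hv.1 hA.1
    (h := fun x => A x (v x)) (fun x => ((A x).le_opNorm _).trans_eq (mul_comm _ _)) hM
  refine ⟨⟨?_, h1.trans_lt ?_⟩, h1⟩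
  · exact (ContinuousLinearMap.apply ℝ Plane).flip.aestronglyMeasurable_comp₂ hA.1 hv.1
  · exact ENNReal.add_lt_top.2 ⟨hA.2, ENNReal.mul_lt_top ENNReal.ofReal_lt_top
      (ENNReal.rpow_lt_top_of_nonneg (by linarith) hv.2.ne)⟩

/-- The transport term does not contribute to the energy: `∫ (u·∇v)·v = 0` for weakly
divergence-free `u`. -/
theorem integral_inner_fderiv_apply_self {p M M' : ℝ} (hp : 2 ≤ p) {u v : Plane → Plane}
    (hu : MemLp u (ENNReal.ofReal p)) (hdiv : IsWeaklyDivFree u) (hv : ContDiff ℝ ∞ v)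
    (hv2 : MemLp v 2) (hM : ∀ x, ‖v x‖ ≤ M) (hdv2 : MemLp (fderiv ℝ v) 2)
    (hM' : ∀ x, ‖fderiv ℝ v x‖ ≤ M') :
    ∫ x, inner ℝ (fderiv ℝ v x (u x)) (v x) = 0 := by
  have hvd : Differentiable ℝ v := hv.differentiable (by simp)
  have hM0 : 0 ≤ M := (norm_nonneg _).trans (hM 0)
  have hI : Integrable fun x => inner ℝ (fderiv ℝ v x (u x)) (v x) :=
    integrable_inner_of_memLp_two (memLp_two_clm_apply' hp hdv2 hu hM').1 hv2
  have hJ : Integrable fun x => ‖v x‖ ^ 2 * ‖u x‖ := by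
    have h1 : MemLp (fun x => ‖u x‖ * ‖v x‖) 2 :=
      ⟨hu.1.norm.mul hv2.1.norm, (eLpNorm_two_le_of_norm_le_mul hp hM0 hu.1 hv2.1
        (h := fun x => ‖u x‖ * ‖v x‖) (fun x => by simp) hM).trans_lt
        (ENNReal.add_lt_top.2 ⟨hv2.2, ENNReal.mul_lt_top ENNReal.ofReal_lt_top
          (ENNReal.rpow_lt_top_of_nonneg (by linarith) hu.2.ne)⟩)⟩
    refine (integrable_inner_of_memLp_two h1 hv2.norm).congr (Eventually.of_forall fun x => ?_)
    simp
    ring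
  let χ : ContDiffBump (0 : Plane) := ⟨1, 2, one_pos, by norm_num⟩
  have hχ : ContDiff ℝ ∞ χ := χ.contDiff
  obtain ⟨C, hC⟩ := (hχ.continuous_fderiv (by simp)).bounded_above_of_compact_support
    (χ.hasCompactSupport.fderiv ℝ)
  -- The weak divergence condition is tested with `χ(aₙ x) ‖v x‖²`, where `aₙ → 0`. The gradient of
  -- the cutoff contributes `aₙ` times a quantity dominated by `C ‖v‖² ‖u‖`, integrable by `hJ`, and
  -- disappears in the limit.
  set a : ℕ → ℝ := fun n => ((n : ℝ) + 1)⁻¹ with ha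
  have ha0 : ∀ n, 0 < a n := fun n => by positivity
  have halim : Tendsto a atTop (𝓝 0) := by
    simpa [ha, one_div] using tendsto_one_div_add_atTop_nhds_zero_nat (𝕜 := ℝ)
  have hχn : ∀ n, ContDiff ℝ ∞ fun x : Plane => χ (a n • x) := fun n =>
    hχ.comp (contDiff_const_smul _)
  have hχnc : ∀ n, HasCompactSupport fun x : Plane => χ (a n • x) := fun n =>
    χ.hasCompactSupport.comp_homeomorph (Homeomorph.smulOfNeZero (a n) (ha0 n).ne')
  have hχnd : ∀ n x e, fderiv ℝ (fun x : Plane => χ (a n • x)) x e = a n * fderiv ℝ χ (a n • x) e := by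
    intro n x e
    have h1 := ((hχ.differentiable (by simp)) (a n • x)).hasFDerivAt.comp x
      ((hasFDerivAt_id x).const_smul (a n))
    have h2 : fderiv ℝ (fun x : Plane => χ (a n • x)) x = _ := h1.fderiv
    rw [h2]
    simp
  have hsq : ContDiff ℝ ∞ fun x => ‖v x‖ ^ 2 := hv.norm_sq ℝ
  have hsqd : ∀ x e, fderiv ℝ (fun x => ‖v x‖ ^ 2) x e = 2 * inner ℝ (fderiv ℝ v x e) (v x) := by
    intro x e
    have h1 : fderiv ℝ (fun x => ‖v x‖ ^ 2) x = _ := ((hvd x).hasFDerivAt.norm_sq).fderiv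
    rw [h1]
    simp [real_inner_comm]
  have hpt : ∀ n x, fderiv ℝ (fun x => χ (a n • x) * ‖v x‖ ^ 2) x (u x)
      = χ (a n • x) * (2 * inner ℝ (fderiv ℝ v x (u x)) (v x))
        + ‖v x‖ ^ 2 * (a n * fderiv ℝ χ (a n • x) (u x)) := by
    intro n x
    rw [fderiv_fun_mul ((hχn n).differentiable (by simp) x) (hsq.differentiable (by simp) x)]
    simp only [add_apply, smul_apply, smul_eq_mul, hχnd, hsqd]
  have hzero : ∀ n, ∫ x, (χ (a n • x) * (2 * inner ℝ (fderiv ℝ v x (u x)) (v x))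
        + ‖v x‖ ^ 2 * (a n * fderiv ℝ χ (a n • x) (u x))) = 0 := by
    intro n
    have := hdiv _ ((hχn n).mul hsq) (hχnc n).mul_right
    simpa only [hpt] using this
  have hlim : Tendsto (fun n => ∫ x, (χ (a n • x) * (2 * inner ℝ (fderiv ℝ v x (u x)) (v x))
        + ‖v x‖ ^ 2 * (a n * fderiv ℝ χ (a n • x) (u x)))) atTop
      (𝓝 (∫ x, 2 * inner ℝ (fderiv ℝ v x (u x)) (v x))) := by
    refine tendsto_integral_of_dominated_convergence
      (fun x => ‖2 * inner ℝ (fderiv ℝ v x (u x)) (v x)‖ + C * (‖v x‖ ^ 2 * ‖u x‖)) ?_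
      ((hI.const_mul 2).norm.add (hJ.const_mul C)) ?_ ?_
    · intro n
      refine ((hχn n).continuous.aestronglyMeasurable.mul (hI.const_mul 2).1).add
        ((hv2.1.norm.pow 2).mul (AEStronglyMeasurable.const_mul ?_ _))
      have h1 : Continuous fun x : Plane => fderiv ℝ χ (a n • x) :=
        (hχ.continuous_fderiv (by simp)).comp (continuous_const_smul _)
      exact (ContinuousLinearMap.apply ℝ ℝ).flip.aestronglyMeasurable_comp₂
        h1.aestronglyMeasurable hu.1
    · intro n
      refine Eventually.of_forall fun x => (norm_add_le _ _).trans (add_le_add ?_ ?_)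
      · rw [norm_mul]
        refine mul_le_of_le_one_left (norm_nonneg _) ?_
        rw [Real.norm_of_nonneg χ.nonneg]
        exact χ.le_one
      · rw [norm_mul, norm_mul, Real.norm_of_nonneg (by positivity : 0 ≤ ‖v x‖ ^ 2),
          Real.norm_of_nonneg (ha0 n).le]
        have h1 : a n ≤ 1 := by
          rw [ha]
          exact inv_le_one_of_one_le₀ (by linarith [n.cast_nonneg (α := ℝ)])
        have h2 : ‖fderiv ℝ χ (a n • x) (u x)‖ ≤ C * ‖u x‖ :=
          (fderiv ℝ χ (a n • x)).le_of_opNorm_le (hC _) _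
        calc ‖v x‖ ^ 2 * (a n * ‖fderiv ℝ χ (a n • x) (u x)‖)
            ≤ ‖v x‖ ^ 2 * (1 * (C * ‖u x‖)) := by gcongr
          _ = _ := by ring
    · refine Eventually.of_forall fun x => ?_
      have h0 : Tendsto (fun n => a n • x) atTop (𝓝 0) := by
        simpa using halim.smul_const x
      have h1 : Tendsto (fun n => χ (a n • x)) atTop (𝓝 1) := by
        have := (hχ.continuous.tendsto 0).comp h0
        rwa [χ.one_of_mem_closedBall (by simp [χ])] at this
      have h2 : Tendsto (fun n => fderiv ℝ χ (a n • x) (u x)) atTop (𝓝 (fderiv ℝ χ 0 (u x))) :=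
        (((hχ.continuous_fderiv (by simp)).clm_apply continuous_const).tendsto 0).comp h0
      have h3 := (h1.mul_const (2 * inner ℝ (fderiv ℝ v x (u x)) (v x))).add
        ((halim.mul h2).const_mul (‖v x‖ ^ 2))
      simpa using h3
  have h4 := tendsto_nhds_unique hlim (by simp only [hzero]; exact tendsto_const_nhds)
  rw [integral_const_mul] at h4
  linarith

/-- The nonlinear terms of two Euler solutions, tested against `φ`, in terms of their
difference `v`. -/
theorem integral_inner_fderiv_sub_eq {p M M' : ℝ} (hp : 2 ≤ p) {u₁ u₂ v φ : Plane → Plane}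
    {G : Plane → Plane →L[ℝ] Plane} (hu₁ : MemLp u₁ (ENNReal.ofReal p))
    (hu₂ : MemLp u₂ (ENNReal.ofReal p)) (hG : MemLp G (ENNReal.ofReal p))
    (hw : HasWeakGradient u₁ G) (hdiv₂ : IsWeaklyDivFree u₂) (hv : ContDiff ℝ ∞ v)
    (hvw : u₁ - u₂ =ᵐ[volume] v) (hdiv : ∀ x, divergenceAt v x = 0) (hM : ∀ x, ‖v x‖ ≤ M)
    (hv2 : MemLp v 2) (hM' : ∀ x, ‖fderiv ℝ v x‖ ≤ M') (hφ : IsDivFreeTest φ) :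
    (∫ x, inner ℝ (u₁ x) (fderiv ℝ φ x (u₁ x))) - ∫ x, inner ℝ (u₂ x) (fderiv ℝ φ x (u₂ x))
      = - ∫ x, inner ℝ (G x (v x) + fderiv ℝ v x (u₂ x)) (φ x) := by
  have hvd : Differentiable ℝ v := hv.differentiable (by simp)
  have hφd : Differentiable ℝ φ := hφ.contDiff.differentiable (by simp)
  have hvp : MemLp v (ENNReal.ofReal p) := (memLp_congr_ae hvw).1 (hu₁.sub hu₂)
  have h1 := hw.integral_inner_fderiv_apply hv hdiv hφ
  have hdvu : MemLp (fun x => fderiv ℝ v x (u₂ x)) (ENNReal.ofReal p) :=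
    memLp_clm_apply (hv.continuous_fderiv (by simp)).aestronglyMeasurable hM' hu₂
  have i2 := hφ.integrable_inner hp hdvu
  have i3 := hφ.integrable_inner_fderiv hp hvp hu₂
  have h2 : ∫ x, inner ℝ (v x) (fderiv ℝ φ x (u₂ x))
      = - ∫ x, inner ℝ (fderiv ℝ v x (u₂ x)) (φ x) := by
    -- Weak incompressibility of `u₂`, tested with the scalar `v·φ`, integrates `(u₂·∇)` by parts;
    -- no derivative of `u₂` is needed.
    have h3 := hdiv₂ (fun x => inner ℝ (v x) (φ x)) (hv.inner ℝ hφ.contDiff)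
      (hφ.hasCompactSupport.mono fun x hx => by
        contrapose! hx
        simp only [Function.mem_support, ne_eq, not_not] at hx ⊢
        rw [hx, inner_zero_right])
    have h4 : ∀ x, fderiv ℝ (fun x => inner ℝ (v x) (φ x)) x (u₂ x)
        = inner ℝ (v x) (fderiv ℝ φ x (u₂ x)) + inner ℝ (fderiv ℝ v x (u₂ x)) (φ x) := fun x =>
      fderiv_inner_apply ℝ (hvd x) (hφd x) _
    simp only [h4] at h3
    rw [integral_add i3 i2] at h3
    linarith
  have iG : Integrable fun x => inner ℝ (G x (v x)) (φ x) :=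
    integrable_inner_of_memLp_two (memLp_two_clm_apply hp hG hv2 hM).1 (hφ.memLp 2)
  simp only [inner_add_left]
  -- What remains is the pointwise splitting `u₁·(u₁·∇)φ - u₂·(u₂·∇)φ = u₁·(v·∇)φ + v·(u₂·∇)φ`: the
  -- first term puts the derivative on `u₁`, the second on `v`.
  rw [integral_add iG i2, neg_add, ← h1, ← h2, ← integral_sub
    (hφ.integrable_inner_fderiv hp hu₁ hu₁) (hφ.integrable_inner_fderiv hp hu₂ hu₂),
    ← integral_add (hφ.integrable_inner_fderiv hp hu₁ hvp) i3]
  refine integral_congr_ae ?_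
  filter_upwards [hvw] with x hx
  have hx' : u₁ x = u₂ x + v x := by rw [← hx]; simp
  rw [← sub_eq_zero, hx']
  simp only [inner_add_left, inner_add_right, map_add]
  ring

/-! ### The energy inequality for the difference -/

theorem continuousOn_toReal_eLpNorm {E : Type*} [NormedAddCommGroup E] {q : ℝ≥0∞} (hq : 1 ≤ q)
    {f : ℝ → Plane → E} {s : Set ℝ} (hf : ∀ t ∈ s, MemLp (f t) q)
    (h : ∀ t ∈ s, Tendsto (fun τ => eLpNorm (f τ - f t) q) (𝓝[s] t) (𝓝 0)) :
    ContinuousOn (fun t => (eLpNorm (f t) q).toReal) s := by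
  intro t ht
  have : Fact (1 ≤ q) := ⟨hq⟩
  have h1 := (ENNReal.continuousAt_toReal ENNReal.zero_ne_top).tendsto.comp (h t ht)
  rw [ENNReal.toReal_zero] at h1
  rw [ContinuousWithinAt, tendsto_iff_norm_sub_tendsto_zero]
  refine squeeze_zero' (Eventually.of_forall fun _ => norm_nonneg _) ?_ h1
  filter_upwards [self_mem_nhdsWithin] with τ hτ
  have h2 := abs_norm_sub_norm_le ((hf τ hτ).toLp (f τ)) ((hf t ht).toLp (f t))
  rwa [← MemLp.toLp_sub, Lp.norm_toLp, Lp.norm_toLp, Lp.norm_toLp] at h2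

section Regularity

variable {p T : ℝ} {u : ℝ → Plane → Plane} {G : ℝ → Plane → Plane →L[ℝ] Plane}

theorem one_le_ofReal_of_two_le (hp : 2 ≤ p) : 1 ≤ ENNReal.ofReal p := by
  rw [← ENNReal.ofReal_one]
  exact ENNReal.ofReal_le_ofReal (by linarith)

theorem IsContinuousW1p.continuousOn_norm (hp : 2 ≤ p) (h : IsContinuousW1p p T u G) :
    ContinuousOn (fun t => (eLpNorm (u t) (ENNReal.ofReal p)).toReal) (Ico 0 T) :=
  continuousOn_toReal_eLpNorm (one_le_ofReal_of_two_le hp) h.memLp fun t ht =>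
    tendsto_of_tendsto_of_tendsto_of_le_of_le tendsto_const_nhds (h.continuous t ht)
      (fun _ => zero_le) fun _ => le_self_add

theorem IsContinuousW1p.continuousOn_norm_grad (hp : 2 ≤ p) (h : IsContinuousW1p p T u G) :
    ContinuousOn (fun t => (eLpNorm (G t) (ENNReal.ofReal p)).toReal) (Ico 0 T) :=
  continuousOn_toReal_eLpNorm (one_le_ofReal_of_two_le hp) h.memLp_grad fun t ht =>
    tendsto_of_tendsto_of_tendsto_of_le_of_le tendsto_const_nhds (h.continuous t ht)
      (fun _ => zero_le) fun _ => le_add_self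

end Regularity

theorem exists_eLpNorm_le_of_continuousOn {E : Type*} [NormedAddCommGroup E] {q : ℝ≥0∞}
    {f : ℝ → Plane → E} {T t₀ : ℝ} (ht₀ : t₀ ∈ Ico 0 T) (hf : ∀ t ∈ Ico 0 T, MemLp (f t) q)
    (hc : ContinuousOn (fun t => (eLpNorm (f t) q).toReal) (Ico 0 T)) :
    ∃ g : ℝ≥0∞, g ≠ ⊤ ∧ ∀ t ∈ Icc 0 t₀, eLpNorm (f t) q ≤ g := by
  have hsub : Icc 0 t₀ ⊆ Ico 0 T := fun x hx => ⟨hx.1, hx.2.trans_lt ht₀.2⟩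
  obtain ⟨C, hC⟩ := isCompact_Icc.exists_bound_of_continuousOn (hc.mono hsub)
  refine ⟨ENNReal.ofReal C, ENNReal.ofReal_ne_top, fun t ht => ?_⟩
  rw [← ENNReal.ofReal_toReal (hf t (hsub ht)).2.ne]
  exact ENNReal.ofReal_le_ofReal ((le_abs_self _).trans (hC t ht))

theorem divergenceAt_eq_zero_of_isWeaklyDivFree {v : Plane → Plane} (hv : ContDiff ℝ ∞ v)
    (h : IsWeaklyDivFree v) (x : Plane) : divergenceAt v x = 0 := by
  have hc : Continuous (divergenceAt v) := by
    unfold divergenceAt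
    refine continuous_finsetSum _ fun i _ => ?_
    exact (EuclideanSpace.proj (𝕜 := ℝ) i).continuous.comp
      ((hv.continuous_fderiv (by simp)).clm_apply continuous_const)
  have h1 : divergenceAt v =ᵐ[volume] fun _ => 0 := by
    refine ae_eq_zero_of_integral_contDiff_smul_eq_zero hc.locallyIntegrable fun ψ hψ hψc => ?_
    have h2 := integral_fderiv_apply_eq_neg hψ hψc hv
    rw [h ψ hψ hψc] at h2
    simp only [smul_eq_mul]
    linarith
  exact congrFun ((hc.ae_eq_iff_eq volume continuous_const).1 h1) x

theorem IsWeaklyDivFree.sub {f g : Plane → Plane} (hf : IsWeaklyDivFree f) (hg : IsWeaklyDivFree g)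
    (hfi : LocallyIntegrable f) (hgi : LocallyIntegrable g) : IsWeaklyDivFree (f - g) := by
  intro ψ hψ hc
  have hi : ∀ f : Plane → Plane, LocallyIntegrable f → Integrable fun x => fderiv ℝ ψ x (f x) := by
    intro f hf
    obtain ⟨N, hN, hNv⟩ : ∃ N : Plane → Plane, (Continuous N ∧ HasCompactSupport N) ∧
        ∀ (u : Plane) x, inner ℝ u (N x) = fderiv ℝ ψ x u :=
      ⟨fun x => (InnerProductSpace.toDual ℝ Plane).symm (fderiv ℝ ψ x),
        ⟨(InnerProductSpace.toDual ℝ Plane).symm.continuous.comp (hψ.continuous_fderiv (by simp)),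
          (hc.fderiv ℝ).comp_left (map_zero _)⟩, fun u x => by
        rw [real_inner_comm, InnerProductSpace.toDual_symm_apply]⟩
    simpa only [hNv] using LocallyIntegrable.integrable_inner_of_hasCompactSupport hf hN.1 hN.2
  simp only [Pi.sub_apply, map_sub]
  rw [integral_sub (hi f hfi) (hi g hgi), hf ψ hψ hc, hg ψ hψ hc, sub_zero]

theorem IsWeaklyDivFree.congr_ae {f g : Plane → Plane} (hf : IsWeaklyDivFree f)
    (h : f =ᵐ[volume] g) : IsWeaklyDivFree g := by
  intro ψ hψ hc
  rw [← hf ψ hψ hc]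
  refine integral_congr_ae ?_
  filter_upwards [h] with x hx
  rw [hx]

theorem norm_clm_plane_le {F : Type*} [NormedAddCommGroup F] [NormedSpace ℝ F]
    (L : Plane →L[ℝ] F) :
    ‖L‖ ≤ ‖L (EuclideanSpace.single 0 1)‖ + ‖L (EuclideanSpace.single 1 1)‖ := by
  refine L.opNorm_le_bound (by positivity) fun x => ?_
  rw [clm_plane_apply L x]
  refine (norm_add_le _ _).trans ?_
  rw [norm_smul, norm_smul, add_mul]
  have h := fun i => PiLp.norm_apply_le x i
  have h0 := h 0
  have h1 := h 1
  rw [mul_comm ‖x 0‖, mul_comm ‖x 1‖]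
  gcongr

theorem homSobolevNorm_zero {f : Plane → Plane} (hf : MemLp f 2) :
    homSobolevNorm 0 f = eLpNorm f 2 := by
  rw [homSobolevNorm, dif_pos hf]
  simp only [Real.rpow_zero, one_smul]
  rw [← Lp.enorm_def, ← ofReal_norm, Lp.norm_fourier_eq, Lp.norm_toLp,
    ENNReal.ofReal_toReal (memLp_complexifyVec hf).2.ne]
  exact eLpNorm_congr_norm_ae (Eventually.of_forall fun x => norm_complexifyVec _)

/-- The data needed for the energy estimate at a fixed time: a smooth representative `v` of the
difference and the quadratic term `F = v·∇u₁ + u₂·∇v ∈ L²`. -/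
theorem exists_energy_data : ∃ c : ℝ, 0 < c ∧ ∀ (p η C T : ℝ) (u₁ u₂ : ℝ → Plane → Plane)
    (G₁ G₂ : ℝ → Plane → Plane →L[ℝ] Plane), 2 ≤ p → 0 ≤ C →
    IsGevreyEulerPair p η C T u₁ u₂ G₁ G₂ → ∀ t₀ ∈ Ico 0 T, ∃ L : ℝ, 0 ≤ L ∧
    ∀ t ∈ Icc 0 t₀, ∃ F : Lp Plane 2 (volume : Measure Plane), ‖F‖ ≤ L ∧
      (∀ φ (hφ : IsDivFreeTest φ),
        (∫ x, inner ℝ (u₁ t x) (fderiv ℝ φ x (u₁ t x)))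
          - ∫ x, inner ℝ (u₂ t x) (fderiv ℝ φ x (u₂ t x))
          = - inner ℝ F ((hφ.memLp 2).toLp φ)) ∧
      ∀ hw : MemLp (u₁ t - u₂ t) 2, ∀ σ R : ℝ, 2 ≤ σ → 0 < R →
        |inner ℝ F (hw.toLp (u₁ t - u₂ t))| ≤ (eLpNorm (G₁ t) (ENNReal.ofReal p)).toReal
          * (c * R * (l2Norm (u₁ t - u₂ t) + R ^ (-σ) * (C ^ (σ + 1) * σ ^ (σ * η)))) ^ (2 / p)
          * l2Norm (u₁ t - u₂ t) ^ (2 - 2 / p) := by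
  obtain ⟨c, hc, hrep⟩ := exists_smooth_representative
  refine ⟨c, hc, fun p η C T u₁ u₂ G₁ G₂ hp hC H t₀ ht₀ => ?_⟩
  set B : ℝ → ℝ := fun σ => C ^ (σ + 1) * σ ^ (σ * η) with hB
  have hB0 : ∀ σ, 0 ≤ σ → 0 ≤ B σ := fun σ hσ => by positivity
  obtain ⟨g₁, hg₁, hg₁'⟩ := exists_eLpNorm_le_of_continuousOn ht₀ H.regular₁.memLp_grad
    (H.regular₁.continuousOn_norm_grad hp)
  obtain ⟨g₂, hg₂, hg₂'⟩ := exists_eLpNorm_le_of_continuousOn ht₀ H.regular₂.memLp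
    (H.regular₂.continuousOn_norm hp)
  -- The sup bound at `σ = 2`, `R = 1`, with the `L²` norm replaced by its Gevrey bound `B 0`. Here
  -- `M`, `M'` and `Λ` only have to be finite and uniform on `[0, t₀]`; the sharp estimate enters
  -- through free `σ` and `R` below.
  set M := c * 1 * (B 0 + 1 ^ (-(2 : ℝ)) * B 2) with hMd
  set M' := c * (B 1 + B 3) with hM'd
  set Λ : ℝ≥0∞ := (ENNReal.ofReal (B 0) + ENNReal.ofReal M * g₁ ^ (p / 2))
    + (ENNReal.ofReal (2 * B 1) + ENNReal.ofReal (2 * M') * g₂ ^ (p / 2)) with hΛ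
  have hΛt : Λ ≠ ⊤ := by
    have h1 : g₁ ^ (p / 2) ≠ ⊤ := ENNReal.rpow_ne_top_of_nonneg (by linarith) hg₁
    have h2 : g₂ ^ (p / 2) ≠ ⊤ := ENNReal.rpow_ne_top_of_nonneg (by linarith) hg₂
    exact ENNReal.add_ne_top.2 ⟨ENNReal.add_ne_top.2 ⟨ENNReal.ofReal_ne_top,
      ENNReal.mul_ne_top ENNReal.ofReal_ne_top h1⟩, ENNReal.add_ne_top.2 ⟨ENNReal.ofReal_ne_top,
      ENNReal.mul_ne_top ENNReal.ofReal_ne_top h2⟩⟩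
  refine ⟨Λ.toReal, ENNReal.toReal_nonneg, fun t ht => ?_⟩
  have htI : t ∈ Ico 0 T := ⟨ht.1, ht.2.trans_lt ht₀.2⟩
  have hgev := H.gevrey t htI
  obtain ⟨v, hv, hvw, hvb, hdvb, hdv2⟩ := hrep (u₁ t - u₂ t) B hB0 hgev
  have hw2 : MemLp (u₁ t - u₂ t) 2 := memLp_of_homSobolevNorm_le (hgev 0 le_rfl)
  have hv2 : MemLp v 2 := (memLp_congr_ae hvw).1 hw2
  have hl2 : l2Norm v = l2Norm (u₁ t - u₂ t) := by
    rw [l2Norm, l2Norm, eLpNorm_congr_ae hvw]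
  have hv0 : eLpNorm v 2 ≤ ENNReal.ofReal (B 0) := by
    rw [← eLpNorm_congr_ae hvw, ← homSobolevNorm_zero hw2]
    exact hgev 0 le_rfl
  have hD0 : l2Norm (u₁ t - u₂ t) ≤ B 0 := by
    rw [← hl2]
    exact ENNReal.toReal_le_of_le_ofReal (hB0 0 le_rfl) hv0
  have hvM : ∀ x, ‖v x‖ ≤ M := fun x => (hvb 2 1 x le_rfl one_pos).trans (by
    rw [hMd]; gcongr)
  have hdvm : AEStronglyMeasurable (fderiv ℝ v) :=
    (hv.continuous_fderiv (by simp)).aestronglyMeasurable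
  have hdvM : ∀ x, ‖fderiv ℝ v x‖ ≤ 2 * M' := fun x => by
    refine (norm_clm_plane_le _).trans ?_
    have h0 := hdvb x (EuclideanSpace.single 0 1)
    have h1 := hdvb x (EuclideanSpace.single 1 1)
    simp only [PiLp.norm_single, norm_one, mul_one] at h0 h1
    linarith
  have hdvL : eLpNorm (fderiv ℝ v) 2 ≤ ENNReal.ofReal (2 * B 1) := by
    have hm : ∀ e, AEStronglyMeasurable fun x => fderiv ℝ v x e := fun e =>
      ((hv.continuous_fderiv (by simp)).clm_apply continuous_const).aestronglyMeasurable
    have h := eLpNorm_le_of_norm_le_add (h := fderiv ℝ v) (μ := volume) (p := 2) zero_le_one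
      zero_le_one (hm (EuclideanSpace.single 0 1)) (hm (EuclideanSpace.single 1 1)) (by norm_num)
      fun x => by simpa using norm_clm_plane_le (fderiv ℝ v x)
    rw [ENNReal.ofReal_one, one_mul, one_mul] at h
    refine h.trans ((add_le_add (hdv2 _) (hdv2 _)).trans (le_of_eq ?_))
    have := hB0 1 zero_le_one
    simp only [PiLp.norm_single, norm_one, mul_one]
    rw [← ENNReal.ofReal_add this this, two_mul]
  have hdvL2 : MemLp (fderiv ℝ v) 2 := ⟨hdvm, hdvL.trans_lt ENNReal.ofReal_lt_top⟩
  have hdiv₂ : IsWeaklyDivFree (u₂ t) := H.euler₂.divFree t htI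
  have hdivv : ∀ x, divergenceAt v x = 0 := by
    refine divergenceAt_eq_zero_of_isWeaklyDivFree hv (IsWeaklyDivFree.congr_ae ?_ hvw)
    exact IsWeaklyDivFree.sub (H.euler₁.divFree t htI) hdiv₂
      (H.regular₁.weakGradient t htI).1 (H.regular₂.weakGradient t htI).1
  obtain ⟨m1, e1⟩ := memLp_two_clm_apply hp (H.regular₁.memLp_grad t htI) hv2 hvM
  obtain ⟨m2, e2⟩ := memLp_two_clm_apply' hp hdvL2 (H.regular₂.memLp t htI) hdvM
  have m3 : MemLp (fun x => G₁ t x (v x) + fderiv ℝ v x (u₂ t x)) 2 := m1.add m2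
  refine ⟨m3.toLp _, ?_, fun φ hφ => ?_, fun hw σ R hσ hR => ?_⟩
  · rw [Lp.norm_toLp]
    refine ENNReal.toReal_mono hΛt ((eLpNorm_add_le m1.1 m2.1 (by norm_num)).trans ?_)
    refine add_le_add (e1.trans ?_) (e2.trans ?_)
    · gcongr
      exact hg₁' t ht
    · gcongr
      exact hg₂' t ht
  · rw [integral_inner_fderiv_sub_eq hp (H.regular₁.memLp t htI) (H.regular₂.memLp t htI)
      (H.regular₁.memLp_grad t htI) (H.regular₁.weakGradient t htI) hdiv₂ hv hvw hdivv hvM hv2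
      hdvM hφ, inner_toLp_eq_integral]
    congr 1
    refine integral_congr_ae ?_
    filter_upwards [m3.coeFn_toLp] with x hx
    rw [hx]
  · have h1 : inner ℝ (m3.toLp _) (hw.toLp (u₁ t - u₂ t)) = ∫ x, inner ℝ (G₁ t x (v x)) (v x) := by
      rw [inner_toLp_eq_integral]
      have h2 := integral_inner_fderiv_apply_self hp (H.regular₂.memLp t htI) hdiv₂ hv hv2 hvM hdvL2 hdvM
      rw [← add_zero (∫ x, inner ℝ (G₁ t x (v x)) (v x)), ← h2, ← integral_add
        (integrable_inner_of_memLp_two m1 hv2) (integrable_inner_of_memLp_two m2 hv2)]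
      refine integral_congr_ae ?_
      filter_upwards [m3.coeFn_toLp, hvw] with x hx hx'
      rw [hx, hx', inner_add_left]
    rw [h1, ← hl2]
    exact abs_integral_inner_clm_le hp (H.regular₁.memLp_grad t htI) hv2 fun x => by
      rw [hl2]; exact hvb σ R x hσ hR

theorem IsGevreyEulerPair.memLp_sub {p η C T : ℝ} {u₁ u₂ : ℝ → Plane → Plane}
    {G₁ G₂ : ℝ → Plane → Plane →L[ℝ] Plane} (H : IsGevreyEulerPair p η C T u₁ u₂ G₁ G₂) {t : ℝ}
    (ht : t ∈ Ico 0 T) : MemLp (u₁ t - u₂ t) 2 volume :=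
  memLp_of_homSobolevNorm_le (H.gevrey t ht 0 le_rfl)

theorem IsGevreyEulerPair.l2Norm_sub_le {p η C T : ℝ} {u₁ u₂ : ℝ → Plane → Plane}
    {G₁ G₂ : ℝ → Plane → Plane →L[ℝ] Plane} (H : IsGevreyEulerPair p η C T u₁ u₂ G₁ G₂)
    (hC : 0 ≤ C) {t : ℝ} (ht : t ∈ Ico 0 T) : l2Norm (u₁ t - u₂ t) ≤ C := by
  have h := H.gevrey t ht 0 le_rfl
  rw [homSobolevNorm_zero (H.memLp_sub ht)] at h
  refine ENNReal.toReal_le_of_le_ofReal hC (h.trans (le_of_eq ?_))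
  simp

/-- The energy inequality for the difference of two solutions. -/
theorem exists_energy_inequality : ∃ c : ℝ, 0 < c ∧ ∀ (p η C T : ℝ) (u₁ u₂ : ℝ → Plane → Plane)
    (G₁ G₂ : ℝ → Plane → Plane →L[ℝ] Plane), 2 ≤ p → 0 ≤ C →
    IsGevreyEulerPair p η C T u₁ u₂ G₁ G₂ → ∀ t₀ ∈ Ico 0 T,
      ContinuousOn (fun t => l2Norm (u₁ t - u₂ t)) (Icc 0 t₀) ∧
      ∀ t ∈ Ico 0 t₀, ∃ e : ℝ,
        HasDerivWithinAt (fun t => l2Norm (u₁ t - u₂ t) ^ 2) e (Ici t) t ∧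
        ∀ σ R : ℝ, 2 ≤ σ → 0 < R →
          e ≤ 2 * ((eLpNorm (G₁ t) (ENNReal.ofReal p)).toReal
            * (c * R * (l2Norm (u₁ t - u₂ t) + R ^ (-σ) * (C ^ (σ + 1) * σ ^ (σ * η)))) ^ (2 / p)
            * l2Norm (u₁ t - u₂ t) ^ (2 - 2 / p)) := by
  classical
  obtain ⟨c, hc, hdata⟩ := exists_energy_data
  refine ⟨c, hc, fun p η C T u₁ u₂ G₁ G₂ hp hC H t₀ ht₀ => ?_⟩
  obtain ⟨L, hL, hF⟩ := hdata p η C T u₁ u₂ G₁ G₂ hp hC H t₀ ht₀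
  have hsub : ∀ t ∈ Icc 0 t₀, t ∈ Ico 0 T := fun t ht => ⟨ht.1, ht.2.trans_lt ht₀.2⟩
  choose! F hFL hFw hFb using hF
  -- The default value `0` is never met on `[0, T)`, where the difference is square integrable.
  set w : ℝ → Lp Plane 2 (volume : Measure Plane) := fun t =>
    if h : MemLp (u₁ t - u₂ t) 2 volume then h.toLp _ else 0 with hw
  have hwt : ∀ t (h : MemLp (u₁ t - u₂ t) 2 volume), w t = h.toLp _ := fun t h => dif_pos h
  have hnorm : ∀ t ∈ Ico 0 T, ‖w t‖ = l2Norm (u₁ t - u₂ t) := fun t ht => by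
    rw [hwt t (H.memLp_sub ht), Lp.norm_toLp]; rfl
  have hinner : ∀ t ∈ Ico 0 T, ∀ φ (hφ : IsDivFreeTest φ), inner ℝ (w t) ((hφ.memLp 2).toLp φ)
      = (∫ x, inner ℝ (u₁ t x) (φ x)) - ∫ x, inner ℝ (u₂ t x) (φ x) := fun t ht φ hφ => by
    rw [inner_toLp_eq_integral, hwt t (H.memLp_sub ht),
      ← integral_sub (hφ.integrable_inner hp (H.regular₁.memLp t ht))
        (hφ.integrable_inner hp (H.regular₂.memLp t ht))]
    refine integral_congr_ae ?_
    filter_upwards [(H.memLp_sub ht).coeFn_toLp] with x hx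
    rw [hx, Pi.sub_apply, inner_sub_left]
  have hV : ∀ f ∈ divFreeTests, ∃ φ, ∃ hφ : IsDivFreeTest φ, f = (hφ.memLp 2).toLp φ := by
    rintro f ⟨φ, hφ, hf⟩
    exact ⟨φ, hφ, Lp.ext (hf.trans (hφ.memLp 2).coeFn_toLp.symm)⟩
  have hmem : ∀ t ∈ Icc 0 t₀, w t ∈ (Submodule.span ℝ divFreeTests).topologicalClosure := by
    intro t ht
    have htI := hsub t ht
    rw [hwt t (H.memLp_sub htI)]
    exact toLp_mem_closure_divFreeTests _ (IsWeaklyDivFree.sub (H.euler₁.divFree t htI)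
      (H.euler₂.divFree t htI) (H.regular₁.weakGradient t htI).1 (H.regular₂.weakGradient t htI).1)
  have hcont : ∀ f ∈ divFreeTests, ContinuousOn (fun τ => inner ℝ (w τ) f) (Icc 0 t₀) := by
    intro f hf
    obtain ⟨φ, hφ, rfl⟩ := hV f hf
    refine (((H.regular₁.continuousOn_integral_inner hp hφ).sub
      (H.regular₂.continuousOn_integral_inner hp hφ)).mono hsub).congr fun t ht => ?_
    exact hinner t (hsub t ht) φ hφ
  have hder : ∀ f ∈ divFreeTests, ∀ t ∈ Ico 0 t₀,
      HasDerivWithinAt (fun τ => inner ℝ (w τ) f) (-inner ℝ (F t) f) (Ici t) t := by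
    intro f hf t ht
    obtain ⟨φ, hφ, rfl⟩ := hV f hf
    have htI := hsub t ⟨ht.1, ht.2.le⟩
    rw [← hFw t ⟨ht.1, ht.2.le⟩ φ hφ]
    refine ((H.euler₁.hasDerivWithinAt_integral_inner hp H.regular₁ hφ t htI).sub
      (H.euler₂.hasDerivWithinAt_integral_inner hp H.regular₂ hφ t htI)).congr_of_eventuallyEq ?_ ?_
    · filter_upwards [Ico_mem_nhdsGE htI.2] with τ hτ
      exact hinner τ ⟨htI.1.trans hτ.1, hτ.2⟩ φ hφ
    · exact hinner t htI φ hφ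
  obtain ⟨h1, h2⟩ := hasDerivWithinAt_norm_sq_of_weak_deriv hL hmem hcont hder
    fun t ht => hFL t ⟨ht.1, ht.2.le⟩
  refine ⟨h1.norm.congr fun t ht => (hnorm t (hsub t ht)).symm, fun t ht => ?_⟩
  have htI := hsub t ⟨ht.1, ht.2.le⟩
  refine ⟨_, (h2 t ht).congr_of_eventuallyEq ?_ ?_, fun σ R hσ hR => ?_⟩
  · filter_upwards [Ico_mem_nhdsGE htI.2] with τ hτ
    rw [hnorm τ ⟨htI.1.trans hτ.1, hτ.2⟩]
  · rw [hnorm t htI]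
  · have h := hFb t ⟨ht.1, ht.2.le⟩ (H.memLp_sub htI) σ R hσ hR
    rw [hwt t (H.memLp_sub htI)]
    linarith [neg_abs_le (inner ℝ (F t) ((H.memLp_sub htI).toLp (u₁ t - u₂ t)))]

/-! ### Choice of the Sobolev order and Osgood's lemma -/

/-- Optimising the interpolation bound over the order `σ` of the Gevrey seminorm. -/
theorem exists_interpolation_bound_le {c C D s : ℝ} (hc : 0 < c) (hs : 0 < s) (hD : 0 < D)
    (hDC : D ≤ C) : ∃ σ R : ℝ, 2 ≤ σ ∧ 0 < R ∧
      (c * R * (D + R ^ (-σ) * (C ^ (σ + 1) * σ ^ (σ * (1 / s))))) ^ s * D ^ (2 - s)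
        ≤ (2 * c * C * Real.exp 1) ^ s * (D ^ 2 * (2 + Real.log (C / D))) := by
  have hC : 0 < C := hD.trans_le hDC
  have hlog : 0 ≤ Real.log (C / D) := Real.log_nonneg ((one_le_div hD).2 hDC)
  -- This order satisfies `σ ≥ 2` and makes `(C / D)^(1/σ) ≤ e`. The radius `R` is the solution of
  -- `R^(-σ) C^(σ+1) σ^(σ/s) = D`, so both terms of the bound equal `D`.
  set σ := 2 + Real.log (C / D) with hσd
  have hσ : 2 ≤ σ := by linarith
  have hσ0 : 0 < σ := by linarith
  set R := C * σ ^ (1 / s) * (C / D) ^ (1 / σ) with hR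
  have hCD : 0 < C / D := div_pos hC hD
  have hσs : 0 < σ ^ (1 / s) := Real.rpow_pos_of_pos hσ0 _
  have hR0 : 0 < R := by positivity
  refine ⟨σ, R, hσ, hR0, ?_⟩
  have h1 : R ^ (-σ) * (C ^ (σ + 1) * σ ^ (σ * (1 / s))) = D := by
    have h2 : R ^ σ = C ^ σ * σ ^ (σ * (1 / s)) * (C / D) := by
      rw [hR, Real.mul_rpow (by positivity) (by positivity), Real.mul_rpow hC.le hσs.le,
        ← Real.rpow_mul hσ0.le, ← Real.rpow_mul hCD.le, one_div_mul_cancel hσ0.ne', Real.rpow_one,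
        mul_comm σ]
    have h3 : 0 < C ^ σ := Real.rpow_pos_of_pos hC _
    have h4 : 0 < σ ^ (σ * (1 / s)) := Real.rpow_pos_of_pos hσ0 _
    rw [Real.rpow_neg hR0.le, h2, Real.rpow_add_one hC.ne']
    field_simp
  have h5 : (C / D) ^ (1 / σ) ≤ Real.exp 1 := by
    rw [Real.rpow_def_of_pos hCD]
    refine Real.exp_le_exp.2 ?_
    rw [mul_one_div, div_le_one hσ0]
    linarith
  rw [h1]
  calc (c * R * (D + D)) ^ s * D ^ (2 - s)
      ≤ ((2 * c * C * Real.exp 1) * σ ^ (1 / s) * D) ^ s * D ^ (2 - s) := by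
        refine mul_le_mul_of_nonneg_right (Real.rpow_le_rpow (by positivity) ?_ hs.le)
          (by positivity)
        rw [hR]
        have : 0 ≤ 2 * c * C * σ ^ (1 / s) * D := by positivity
        nlinarith [mul_le_mul_of_nonneg_left h5 this]
    _ = (2 * c * C * Real.exp 1) ^ s * (D ^ 2 * σ) := by
        rw [Real.mul_rpow (by positivity) hD.le, Real.mul_rpow (by positivity) hσs.le,
          ← Real.rpow_mul hσ0.le, one_div_mul_cancel hs.ne', Real.rpow_one, mul_assoc _ (D ^ s),
          ← Real.rpow_add hD, add_sub_cancel, Real.rpow_two]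
        ring

/-- Because `log (L / D) ≥ log (L / M) > 0`, additive constants are absorbed into a multiple of `log
(L / D)`. The absolute values keep the factor positive for every `M`, including `M ≤ 0`, where no
such `D` exists. -/
theorem two_add_log_div_le {C D L M : ℝ} (hD : 0 < D) (hDC : D ≤ C) (hDM : D ≤ M) (hML : M < L) :
    2 + Real.log (C / D)
      ≤ (1 + (2 + |Real.log (C / L)|) / |Real.log (L / M)|) * Real.log (L / D) := by
  have hM : 0 < M := hD.trans_le hDM
  have hL : 0 < L := hM.trans hML
  have hC : 0 < C := hD.trans_le hDC
  have h1 : 0 < Real.log (L / M) := Real.log_pos ((one_lt_div hM).2 hML)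
  have h2 : Real.log (L / M) ≤ Real.log (L / D) := by gcongr
  have h3 : Real.log (C / D) = Real.log (C / L) + Real.log (L / D) := by
    rw [Real.log_div hC.ne' hD.ne', Real.log_div hC.ne' hL.ne', Real.log_div hL.ne' hD.ne']
    ring
  have h4 : 2 + |Real.log (C / L)|
      ≤ (2 + |Real.log (C / L)|) / |Real.log (L / M)| * Real.log (L / D) := by
    rw [abs_of_pos h1, div_mul_eq_mul_div, le_div_iff₀ h1]
    gcongr
  rw [h3, add_mul, one_mul]
  linarith [le_abs_self (Real.log (C / L))]

/-- Osgood's lemma for the modulus of continuity `r ↦ r log (L / r)`. -/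
theorem div_le_rpow_of_osgood {D a : ℝ → ℝ} {t K L M : ℝ} (ht : 0 ≤ t) (hK : 0 < K) (hL : 0 < L)
    (hML : M < L) (hD : ContinuousOn D (Icc 0 t)) (hD0 : ∀ τ ∈ Icc 0 t, 0 ≤ D τ)
    (hDM : D 0 ≤ M) (ha : ContinuousOn a (Icc 0 t))
    (hder : ∀ τ ∈ Ico 0 t, ∃ e, HasDerivWithinAt (fun τ => D τ ^ 2) e (Ici τ) τ ∧
      (0 < D τ → e ≤ 2 * (K * a τ * (D τ ^ 2 * Real.log (L / D τ))))) :
    D t / L ≤ (D 0 / L) ^ Real.exp (-K * ∫ τ in (0 : ℝ)..t, a τ) := by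
  have hd0 : 0 ≤ D 0 := hD0 0 ⟨le_rfl, ht⟩
  set b : ℝ → ℝ := fun τ => a (projIcc 0 t ht τ) with hb
  have hbc : Continuous b :=
    (continuousOn_iff_continuous_domRestrict.1 ha).comp continuous_projIcc
  have hba : ∀ τ ∈ Icc 0 t, b τ = a τ := fun τ hτ => by rw [hb]; simp only [projIcc_of_mem ht hτ]
  have hint : ∫ τ in (0 : ℝ)..t, a τ = ∫ τ in (0 : ℝ)..t, b τ :=
    intervalIntegral.integral_congr fun τ hτ => (hba τ (by rwa [uIcc_of_le ht] at hτ)).symm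
  choose! e he heb using hder
  -- Raising the initial value by `ε` makes the comparison function positive when `D 0 = 0`; raising
  -- the rate by `ε` makes its differential inequality strict. The bound `ε < L - M` keeps its
  -- initial value below `L`.
  have key : ∀ ε : ℝ, 0 < ε → ε < L - M → D t / L
      ≤ ((D 0 + ε) / L) ^ Real.exp (-K * ((∫ τ in (0 : ℝ)..t, b τ) + ε * t)) := by
    intro ε hε hεL
    have hz : 0 < (D 0 + ε) / L := by positivity
    have hy0 : 0 < -Real.log ((D 0 + ε) / L) := by
      rw [Left.neg_pos_iff]
      exact Real.log_neg hz ((div_lt_one hL).2 (by linarith))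
    -- In the variable `y = log (L / Z)` the equation `Z' = K (b + ε) Z log (L / Z)` is linear, so
    -- `Z = L exp (-y)` is explicit.
    set y : ℝ → ℝ := fun τ =>
      -Real.log ((D 0 + ε) / L) * Real.exp (-K * ((∫ r in (0 : ℝ)..τ, b r) + ε * τ)) with hy
    have hypos : ∀ τ, 0 < y τ := fun τ => mul_pos hy0 (Real.exp_pos _)
    have hyd : ∀ τ, HasDerivAt y (-K * (b τ + ε) * y τ) τ := fun τ => by
      have h1 : HasDerivAt (fun τ => (∫ r in (0 : ℝ)..τ, b r) + ε * τ) (b τ + ε) τ := by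
        simpa using (hbc.integral_hasStrictDerivAt 0 τ).hasDerivAt.fun_add
          ((hasDerivAt_id' τ).const_mul ε)
      refine ((h1.const_mul (-K)).exp.const_mul (-Real.log ((D 0 + ε) / L))).congr_deriv ?_
      rw [hy]
      ring
    have hBd : ∀ τ, HasDerivAt (fun τ => (L * Real.exp (-y τ)) ^ 2)
        (2 * (K * (b τ + ε) * ((L * Real.exp (-y τ)) ^ 2 * y τ))) τ := fun τ => by
      refine (((hyd τ).fun_neg.exp.const_mul L).fun_pow 2).congr_deriv ?_
      push_cast
      ring
    -- The squares are compared, since only `D²` is known to be differentiable. The derivatives need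
    -- comparing only where `D = Z > 0`, so zeros of `D` are harmless.
    have h := image_le_of_deriv_right_lt_deriv_boundary' (hD.pow 2) he
      (B := fun τ => (L * Real.exp (-y τ)) ^ 2) ?_
      (fun τ _ => (hBd τ).continuousAt.continuousWithinAt)
      (fun τ _ => (hBd τ).hasDerivWithinAt) ?_ (right_mem_Icc.2 ht)
    · have h2 : D t ≤ L * Real.exp (-y t) :=
        le_of_sq_le_sq h (by positivity)
      rw [div_le_iff₀' hL, Real.rpow_def_of_pos hz]
      refine h2.trans (le_of_eq ?_)
      rw [hy]
      ring_nf
    · have h3 : L * Real.exp (-y 0) = D 0 + ε := by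
        simp only [hy, intervalIntegral.integral_same, mul_zero, add_zero, Real.exp_zero, mul_one,
          neg_neg, Real.exp_log hz]
        field_simp
      rw [h3]
      exact pow_le_pow_left₀ hd0 (by linarith) 2
    · intro τ hτ hτe
      have hτ' : τ ∈ Icc 0 t := ⟨hτ.1, hτ.2.le⟩
      have hZ : 0 < L * Real.exp (-y τ) := by positivity
      have hDZ : D τ = L * Real.exp (-y τ) := by
        exact (pow_left_inj₀ (hD0 τ hτ') hZ.le two_ne_zero).1 hτe
      have hlog : Real.log (L / D τ) = y τ := by
        rw [hDZ, Real.exp_neg, ← div_eq_mul_inv, div_div_cancel₀ hL.ne', Real.log_exp]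
      refine (heb τ hτ (hDZ ▸ hZ)).trans_lt ?_
      rw [hlog, hba τ hτ', hDZ]
      have := hypos τ
      gcongr
      linarith
  rw [hint]
  have hlim : Tendsto (fun ε : ℝ => ((D 0 + ε) / L) ^
      Real.exp (-K * ((∫ τ in (0 : ℝ)..t, b τ) + ε * t))) (𝓝[>] 0)
      (𝓝 (((D 0 + 0) / L) ^ Real.exp (-K * ((∫ τ in (0 : ℝ)..t, b τ) + 0 * t)))) := by
    refine Tendsto.rpow ?_ ?_ (Or.inr (Real.exp_pos _))
    · exact ((Continuous.tendsto (by fun_prop) 0).mono_left nhdsWithin_le_nhds)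
    · exact ((Continuous.tendsto (by fun_prop) 0).mono_left nhdsWithin_le_nhds)
  rw [add_zero, zero_mul, add_zero] at hlim
  refine ge_of_tendsto hlim ?_
  filter_upwards [Ioo_mem_nhdsGT (sub_pos.2 hML)] with ε hε
  exact key ε hε.1 hε.2

/-! ### Stability and uniqueness -/

/-- Stability of the Euler equations under Gevrey differences, in units of `L`. -/
theorem exists_stability_constant {p C : ℝ} (hp : 2 ≤ p) (hC : 0 ≤ C) {L M : ℝ} (hL : 0 < L)
    (hML : M < L) : ∃ K : ℝ, 0 < K ∧
      ∀ (T : ℝ) (u₁ u₂ : ℝ → Plane → Plane) (G₁ G₂ : ℝ → Plane → Plane →L[ℝ] Plane),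
        IsGevreyEulerPair p (1 / (2 / p)) C T u₁ u₂ G₁ G₂ →
        ∀ t ∈ Ico 0 T, (∀ τ ∈ Icc 0 t, l2Norm (u₁ τ - u₂ τ) ≤ M) →
          l2Norm (u₁ t - u₂ t) / L
            ≤ (l2Norm (u₁ 0 - u₂ 0) / L) ^ Real.exp (-K * gradLpIntegral p G₁ t) := by
  obtain ⟨c, hc, henergy⟩ := exists_energy_inequality
  have hs : 0 < 2 / p := by positivity
  set K₀ := (2 * c * C * Real.exp 1) ^ (2 / p) with hK₀
  set K₁ := 1 + (2 + |Real.log (C / L)|) / |Real.log (L / M)| with hK₁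
  have hK₀0 : 0 ≤ K₀ := by positivity
  have hK₁0 : 0 < K₁ := by positivity
  -- The summand `1` keeps the constant positive when `C = 0`, where `K₀` vanishes.
  refine ⟨K₀ * K₁ + 1, by positivity, fun T u₁ u₂ G₁ G₂ H t ht hM => ?_⟩
  obtain ⟨hcont, hder⟩ := henergy p _ C T u₁ u₂ G₁ G₂ hp hC H t ht
  have hsub : ∀ τ ∈ Icc 0 t, τ ∈ Ico 0 T := fun τ hτ => ⟨hτ.1, hτ.2.trans_lt ht.2⟩
  refine div_le_rpow_of_osgood (D := fun τ => l2Norm (u₁ τ - u₂ τ)) ht.1 (by positivity) hL hML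
    hcont (fun τ _ => ENNReal.toReal_nonneg) (hM 0 ⟨le_rfl, ht.1⟩)
    ((H.regular₁.continuousOn_norm_grad hp).mono hsub) fun τ hτ => ?_
  obtain ⟨e, he, hbound⟩ := hder τ hτ
  refine ⟨e, he, fun hD => ?_⟩
  have hτ' : τ ∈ Icc 0 t := ⟨hτ.1, hτ.2.le⟩
  have hDC := H.l2Norm_sub_le hC (hsub τ hτ')
  obtain ⟨σ, R, hσ, hR, h⟩ := exists_interpolation_bound_le hc hs hD hDC
  refine (hbound σ R hσ hR).trans ?_
  have hlog := two_add_log_div_le hD hDC (hM τ hτ') hML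
  set d := l2Norm (u₁ τ - u₂ τ) with hd
  set a := (eLpNorm (G₁ τ) (ENNReal.ofReal p)).toReal with ha
  have ha0 : 0 ≤ a := ENNReal.toReal_nonneg
  have hlog0 : 0 ≤ Real.log (L / d) :=
    Real.log_nonneg ((one_le_div hD).2 ((hM τ hτ').trans hML.le))
  gcongr 2 * ?_
  rw [mul_assoc]
  calc _ ≤ a * (K₀ * (d ^ 2 * (2 + Real.log (C / d)))) := by gcongr
    _ ≤ a * (K₀ * (d ^ 2 * (K₁ * Real.log (L / d)))) := by gcongr
    _ = K₀ * K₁ * a * (d ^ 2 * Real.log (L / d)) := by ring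
    _ ≤ (K₀ * K₁ + 1) * a * (d ^ 2 * Real.log (L / d)) := by
        gcongr
        linarith

theorem mainTheorem5 (p s C : ℝ) (hp : 2 ≤ p) (hs : s = 2 / p) (hC : 0 ≤ C) :
    -- as long as the difference stays below a fixed level `M < 1`
    (∀ M : ℝ, M < 1 → ∃ K : ℝ, 0 < K ∧
      ∀ (T : ℝ) (u₁ u₂ : ℝ → Plane → Plane) (G₁ G₂ : ℝ → Plane → Plane →L[ℝ] Plane),
        IsGevreyEulerPair p (1 / s) C T u₁ u₂ G₁ G₂ →
        ∀ t ∈ Ico 0 T, (∀ τ ∈ Icc 0 t, l2Norm (u₁ τ - u₂ τ) ≤ M) →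
          l2Norm (u₁ t - u₂ t)
            ≤ l2Norm (u₁ 0 - u₂ 0) ^ Real.exp (-K * gradLpIntegral p G₁ t)) ∧
    -- without restriction on the size of the difference, in units of any `B > C`
    (∀ B : ℝ, C < B → ∃ K : ℝ, 0 < K ∧
      ∀ (T : ℝ) (u₁ u₂ : ℝ → Plane → Plane) (G₁ G₂ : ℝ → Plane → Plane →L[ℝ] Plane),
        IsGevreyEulerPair p (1 / s) C T u₁ u₂ G₁ G₂ →
        ∀ t ∈ Ico 0 T,
          l2Norm (u₁ t - u₂ t) / B
            ≤ (l2Norm (u₁ 0 - u₂ 0) / B) ^ Real.exp (-K * gradLpIntegral p G₁ t)) ∧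
    -- equal initial data give equal solutions
    (∀ (T : ℝ) (u₁ u₂ : ℝ → Plane → Plane) (G₁ G₂ : ℝ → Plane → Plane →L[ℝ] Plane),
      IsGevreyEulerPair p (1 / s) C T u₁ u₂ G₁ G₂ →
      u₁ 0 =ᵐ[volume] u₂ 0 → ∀ t ∈ Ico 0 T, u₁ t =ᵐ[volume] u₂ t) := by
  subst hs
  have hstab : ∀ B : ℝ, C < B → ∃ K : ℝ, 0 < K ∧
      ∀ (T : ℝ) (u₁ u₂ : ℝ → Plane → Plane) (G₁ G₂ : ℝ → Plane → Plane →L[ℝ] Plane),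
        IsGevreyEulerPair p (1 / (2 / p)) C T u₁ u₂ G₁ G₂ →
        ∀ t ∈ Ico 0 T,
          l2Norm (u₁ t - u₂ t) / B
            ≤ (l2Norm (u₁ 0 - u₂ 0) / B) ^ Real.exp (-K * gradLpIntegral p G₁ t) := by
    intro B hB
    -- With level `M = C` and unit `L = B`, the smallness condition is the Gevrey bound at `σ = 0`,
    -- hence automatic.
    obtain ⟨K, hK, h⟩ := exists_stability_constant hp hC (hC.trans_lt hB) hB
    exact ⟨K, hK, fun T u₁ u₂ G₁ G₂ H t ht => h T u₁ u₂ G₁ G₂ H t ht fun τ hτ =>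
      H.l2Norm_sub_le hC ⟨hτ.1, hτ.2.trans_lt ht.2⟩⟩
  refine ⟨fun M hM => ?_, hstab, fun T u₁ u₂ G₁ G₂ H h0 t ht => ?_⟩
  · simpa only [div_one] using exists_stability_constant hp hC one_pos hM
  · obtain ⟨K, hK, h⟩ := hstab (C + 1) (lt_add_one C)
    have hD0 : l2Norm (u₁ 0 - u₂ 0) = 0 := by
      have : u₁ 0 - u₂ 0 =ᵐ[volume] 0 := by
        filter_upwards [h0] with x hx
        simp [hx]
      rw [l2Norm, eLpNorm_congr_ae this, eLpNorm_zero, ENNReal.toReal_zero]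
    have h1 := h T u₁ u₂ G₁ G₂ H t ht
    -- The exponent is an exponential, hence nonzero, so `0` raised to it is `0`.
    rw [hD0, zero_div, Real.zero_rpow (Real.exp_pos _).ne', div_le_iff₀ (by positivity),
      zero_mul] at h1
    have hm := H.memLp_sub ht
    have h2 : eLpNorm (u₁ t - u₂ t) 2 volume = 0 :=
      ((ENNReal.toReal_eq_zero_iff _).1 (h1.antisymm ENNReal.toReal_nonneg)).resolve_right hm.2.ne
    filter_upwards [(eLpNorm_eq_zero_iff hm.1 two_ne_zero).1 h2] with x hx
    exact sub_eq_zero.1 hx
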